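/- **Setting.** An effect algebra is a set $E$ with constants $0,1$ and a partial, commutative, associative operation $+$ such that every $a$ has a unique $a'$ with $a+a'=1$, and $a=0$ whenever $a+1$ is defined; it is ordered by $a\le b$ iff $a+c=b$ for some $c$. It is a $\sigma$-lattice (complete lattice) effect algebra if all nonempty countable (all) subsets have an infimum and a supremum. An element $a$ is sharp if $a\wedge a'=0$. An observable on $E$ is a map $x:\mathcal B(\mathbb R)\to E$ on the Borel sets with $x(\mathbb R)=1$, $x(A\cup B)=x(A)+x(B)$ for disjoint $A,B$, and $x(\bigcup_i A_i)=\bigvee_i x(A_i)$ for increasing sequences $(A_i)$; it is sharp if all its values are sharp. For a Borel function $f$ let $f(x)(B)=x(f^{-1}(B))$. The spectrum $\sigma(x)$ is the least closed set $K$ with $x(K)=1$. For $a\in E$, $q_a$ is the observable with $q_a(\{0\})=a'$, $q_a(\{1\})=a$ and $q_a(B)=0$ for Borel $B$ with $B\cap\{0,1\}=\emptyset$. The Olson order is: $x\preceq_s y$ iff $y((-\infty,t))\le x((-\infty,t))$ for all $t\in\mathbb R$. Let $\mathcal{EO}(E)$ be the set of observables with $\sigma(x)\subseteq[0,1]$,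 partially ordered by $\preceq_s$, and for $x\in\mathcal{EO}(E)$ put $x^-:=f(x)$ with $f(t)=1-t$. Meets and joins of observables below are taken in $\mathcal{EO}(E)$. **Theorem 4.5.** Let $E$ be a $\sigma$-lattice effect algebra. Then $x^-\in\mathcal{EO}(E)$ for $x\in\mathcal{EO}(E)$, and for all $x,y,x_\alpha\in\mathcal{EO}(E)$ and $a,b\in E$: (i) if $x\preceq_s y$, then $y^-\preceq_s x^-$; (ii) $x^{--}=x$; (iii) $q_0^-=q_1$ and $q_1^-=q_0$; (iv) for every countable family $(x_\alpha)$, and for every family if $E$ is a complete lattice effect algebra, the infimum and the supremum exist, $(\bigwedge_\alpha x_\alpha)^-=\bigvee_\alpha x_\alpha^-$ and $(\bigvee_\alpha x_\alpha)^-=\bigwedge_\alpha x_\alpha^-$; (v) $q_a^-=q_{a'}$; (vi) $q_a\wedge q_b=q_{a\wedge b}$ and $q_a\vee q_b=q_{a\vee b}$; (vii) with $g(t)=\min\{t,1-t\}$ and $h(t)=\max\{t,1-t\}$, we have $g(x)\preceq_s x\wedge x^-$ and $x\vee x^-\preceq_s h(x)$; (viii) $q_a$ is a sharp observable iff $a$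 is a sharp element iff $q_a\wedge q_a^-=q_0$. If $E$ is moreover a complete lattice effect algebra, then $\mathcal{EO}(E)$ with $\preceq_s$ and $^-$ is an involution complete lattice, that is, a complete lattice with a map $^-$ satisfying (i) and (ii). -/

import Mathlib

open Set

/-- An effect algebra: a set with a partial binary operation `+` and constants `0`, `1`.
`padd a b = some c` means that `a + b` is defined and equal to `c`, and `padd a b = none` means
that `a + b` is not defined. The equations between values in `Option E` say that
one side is defined iff the other one is, and that the two are then equal. -/
class EffectAlgebra (E : Type*) extends Zero E, One E where
  padd : E → E → Option E
  padd_comm : ∀ a b : E, padd a b = padd b a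
  padd_assoc : ∀ a b c : E,
    ((padd a b).bind fun d => padd d c) = (padd b c).bind fun d => padd a d
  existsUnique_compl : ∀ a : E, ∃! b : E, padd a b = some 1
  eq_zero_of_padd_one : ∀ a : E, (padd a 1).isSome → a = 0

namespace EffectAlgebra

variable {E : Type*} [EffectAlgebra E]

/-- The orthosupplement `a'` of `a`, written `aᶜ`: the unique element with `a + a' = 1`. -/
noncomputable instance instCompl : Compl E := ⟨fun a => (existsUnique_compl a).choose⟩

theorem padd_compl (a : E) : padd a aᶜ = some 1 := (existsUnique_compl a).choose_spec.1

theorem compl_padd (a : E) : padd aᶜ a = some 1 := by rw [padd_comm, padd_compl]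

theorem eq_compl {a b : E} (h : padd a b = some 1) : b = aᶜ :=
  (existsUnique_compl a).unique h (padd_compl a)

theorem assoc_left {a b c d e : E} (h₁ : padd a b = some d) (h₂ : padd d c = some e) :
    ∃ f, padd b c = some f ∧ padd a f = some e := by
  have h := padd_assoc a b c
  rw [h₁, Option.bind_some, h₂] at h
  exact Option.bind_eq_some_iff.1 h.symm

theorem compl_one_eq : (1 : E)ᶜ = 0 :=
  eq_zero_of_padd_one _ (by rw [compl_padd]; rfl)

theorem padd_zero (a : E) : padd a 0 = some a := by
  have h1 : padd (1 : E) 0 = some 1 := by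
    have := padd_compl (1 : E)
    rwa [compl_one_eq] at this
  obtain ⟨f, hf, hf'⟩ := assoc_left (compl_padd a) h1
  have h2 := eq_compl hf'
  have h3 := eq_compl (compl_padd a)
  rw [hf, h2, ← h3]

theorem zero_padd (a : E) : padd 0 a = some a := by rw [padd_comm, padd_zero]

/-- The order of an effect algebra: `a ≤ b` iff `a + c = b` for some `c`. -/
instance instPartialOrder : PartialOrder E where
  le a b := ∃ c, padd a c = some b
  le_refl a := ⟨0, padd_zero a⟩
  le_trans a b c := by
    rintro ⟨d, hd⟩ ⟨e, he⟩
    obtain ⟨f, -, hf⟩ := assoc_left hd he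
    exact ⟨f, hf⟩
  le_antisymm a b := by
    rintro ⟨c, hc⟩ ⟨d, hd⟩
    obtain ⟨f, hf, hf'⟩ := assoc_left hc hd
    have hf0 : f = 0 := by
      have h := padd_assoc aᶜ a f
      rw [compl_padd, hf', Option.bind_some, Option.bind_some, compl_padd] at h
      exact eq_zero_of_padd_one f (by rw [padd_comm, h]; rfl)
    subst hf0
    have hd0 : d = 0 := by
      obtain ⟨g, hg, -⟩ := assoc_left hf (zero_padd (1 : E))
      exact eq_zero_of_padd_one d (by rw [hg]; rfl)
    subst hd0
    rw [padd_zero] at hd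
    exact (Option.some.inj hd).symm

theorem le_def {a b : E} : a ≤ b ↔ ∃ c, padd a c = some b := Iff.rfl

theorem zero_le (a : E) : 0 ≤ a := ⟨a, zero_padd a⟩

theorem le_one (a : E) : a ≤ 1 := ⟨aᶜ, padd_compl a⟩

/-- An element `a` is sharp if `a ∧ a'` exists and is `0`. -/
def IsSharp (a : E) : Prop := IsGLB {a, aᶜ} 0

end EffectAlgebra

/-- A partially ordered set is a complete lattice: every subset has an infimum and a supremum. -/
def IsCompleteLatticeOrder (L : Type*) [PartialOrder L] : Prop :=
  ∀ S : Set L, (∃ m, IsGLB S m) ∧ ∃ m, IsLUB S m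

/-- A partially ordered set is a `σ`-lattice: every nonempty countable subset has an infimum and
a supremum. -/
def IsSigmaLatticeOrder (L : Type*) [PartialOrder L] : Prop :=
  ∀ S : Set L, S.Countable → S.Nonempty → (∃ m, IsGLB S m) ∧ ∃ m, IsLUB S m

/-- An involution (negation) on a partially ordered set: double negation and contraposition. -/
def IsOrderInvolution {L : Type*} [PartialOrder L] (n : L → L) : Prop :=
  (∀ a, n (n a) = a) ∧ ∀ a b, a ≤ b → n b ≤ n a

/-- The Borel subsets of the real line. -/
abbrev BorelSet : Type := {B : Set ℝ // MeasurableSet B}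

/-- An observable on an effect algebra. -/
@[ext]
structure Observable (E : Type*) [EffectAlgebra E] where
  toFun : BorelSet → E
  map_univ : toFun ⟨univ, MeasurableSet.univ⟩ = 1
  map_union : ∀ A B : BorelSet, Disjoint A.1 B.1 →
    EffectAlgebra.padd (toFun A) (toFun B) = some (toFun ⟨A.1 ∪ B.1, A.2.union B.2⟩)
  map_iUnion : ∀ F : ℕ → BorelSet, (∀ i, (F i).1 ⊆ (F (i + 1)).1) →
    IsLUB (range fun i => toFun (F i))
      (toFun ⟨⋃ i, (F i).1, MeasurableSet.iUnion fun i => (F i).2⟩)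

namespace Observable

open EffectAlgebra

variable {E : Type*} [EffectAlgebra E]

instance : CoeFun (Observable E) fun _ => BorelSet → E := ⟨Observable.toFun⟩

theorem map_compl (x : Observable E) (B : BorelSet) : x ⟨B.1ᶜ, B.2.compl⟩ = (x B)ᶜ := by
  apply eq_compl
  rw [x.map_union B ⟨B.1ᶜ, B.2.compl⟩ disjoint_compl_right, ← x.map_univ]
  congr 3
  exact union_compl_self _

theorem map_empty (x : Observable E) : x ⟨∅, MeasurableSet.empty⟩ = 0 := by
  have h := x.map_compl ⟨univ, MeasurableSet.univ⟩
  rw [x.map_univ, compl_one_eq] at h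
  rw [← h]
  congr 2
  exact compl_univ.symm

/-- The value `x((-∞, t))`. -/
def resolution (x : Observable E) (t : ℝ) : E := x ⟨Iio t, measurableSet_Iio⟩

/-- An observable is determined by its spectral resolution. -/
theorem eq_of_resolution {x y : Observable E} (h : ∀ t, x.resolution t = y.resolution t) :
    x = y := by
  have key : ∀ (B : Set ℝ) (hB : MeasurableSet B), x ⟨B, hB⟩ = y ⟨B, hB⟩ := by
    intro B hB
    induction B, hB using MeasurableSpace.induction_on_inter
      (borel_eq_generateFrom_Iio ℝ ▸ BorelSpace.measurable_eq) isPiSystem_Iio with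
    | empty => exact x.map_empty.trans y.map_empty.symm
    | basic t ht =>
      obtain ⟨a, rfl⟩ := ht
      exact h a
    | compl t ht ih =>
      exact (x.map_compl ⟨t, ht⟩).trans ((congrArg _ ih).trans (y.map_compl ⟨t, ht⟩).symm)
    | iUnion f hd hf ih =>
      have hmeas : ∀ n : ℕ, MeasurableSet (⋃ i < n, f i) := fun n =>
        MeasurableSet.biUnion (to_countable _) fun i _ => hf i
      have hfin : ∀ n : ℕ, x ⟨⋃ i < n, f i, hmeas n⟩ = y ⟨⋃ i < n, f i, hmeas n⟩ := by
        intro n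
        induction n with
        | zero =>
          have h0 : (⟨⋃ i < 0, f i, hmeas 0⟩ : BorelSet) = ⟨∅, MeasurableSet.empty⟩ := by
            ext; simp
          rw [h0, x.map_empty, y.map_empty]
        | succ n ihn =>
          have hs : (⟨⋃ i < n + 1, f i, hmeas (n + 1)⟩ : BorelSet)
              = ⟨(⋃ i < n, f i) ∪ f n, (hmeas n).union (hf n)⟩ := by
            apply Subtype.ext
            exact biUnion_lt_succ f n
          have hdis : Disjoint (⋃ i < n, f i) (f n) := by
            simp only [disjoint_iUnion_left]
            intro i hi
            exact hd hi.ne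
          have hx := x.map_union ⟨_, hmeas n⟩ ⟨_, hf n⟩ hdis
          have hy := y.map_union ⟨_, hmeas n⟩ ⟨_, hf n⟩ hdis
          rw [ihn, ih n, hy] at hx
          rw [hs]
          exact (Option.some.inj hx).symm
      have hmono : ∀ n : ℕ, (⋃ i < n, f i) ⊆ ⋃ i < n + 1, f i := fun n => by
        rw [biUnion_lt_succ f n]
        exact subset_union_left
      have hx := x.map_iUnion (fun n => ⟨⋃ i < n, f i, hmeas n⟩) hmono
      have hy := y.map_iUnion (fun n => ⟨⋃ i < n, f i, hmeas n⟩) hmono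
      simp only [hfin] at hx
      have hu : (⋃ n : ℕ, ⋃ i < n, f i) = ⋃ i, f i := by
        ext r
        simp only [mem_iUnion, exists_prop]
        exact ⟨fun ⟨_, i, _, h⟩ => ⟨i, h⟩, fun ⟨i, h⟩ => ⟨i + 1, i, Nat.lt_succ_self i, h⟩⟩
      simpa only [hu] using hx.unique hy
  ext B
  exact key B.1 B.2

/-- The Olson (spectral) order: `x ≤ y` iff `y((-∞, t)) ≤ x((-∞, t))` for every real `t`. -/
instance instPartialOrder : PartialOrder (Observable E) where
  le x y := ∀ t : ℝ, y.resolution t ≤ x.resolution t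
  le_refl _ _ := le_rfl
  le_trans _ _ _ h₁ h₂ t := (h₂ t).trans (h₁ t)
  le_antisymm _ _ h₁ h₂ := eq_of_resolution fun t => le_antisymm (h₂ t) (h₁ t)

/-- The observable `f(x)`, given by `f(x)(B) = x(f⁻¹(B))`. -/
def map (f : ℝ → ℝ) (hf : Measurable f) (x : Observable E) : Observable E where
  toFun B := x ⟨f ⁻¹' B.1, hf B.2⟩
  map_univ := x.map_univ
  map_union A B h := x.map_union ⟨_, hf A.2⟩ ⟨_, hf B.2⟩ (h.preimage f)
  map_iUnion F h := by
    have := x.map_iUnion (fun i => ⟨f ⁻¹' (F i).1, hf (F i).2⟩) fun i => preimage_mono (h i)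
    simpa only [preimage_iUnion] using this

/-- The spectrum: the least closed set `K` with `x(K) = 1`, obtained as the intersection of all
of them. -/
def spectrum (x : Observable E) : Set ℝ :=
  ⋂₀ {K | ∃ hK : IsClosed K, x ⟨K, hK.measurableSet⟩ = 1}

/-- An observable is sharp if all its values are sharp elements. -/
def IsSharp (x : Observable E) : Prop := ∀ B, EffectAlgebra.IsSharp (x B)

open Classical in
/-- The question observable `q_a`: mass `a'` at the point `0` and mass `a` at the point `1`. -/
noncomputable def question (a : E) : Observable E where
  toFun B :=
    if (0 : ℝ) ∈ B.1 then (if (1 : ℝ) ∈ B.1 then 1 else aᶜ)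
    else (if (1 : ℝ) ∈ B.1 then a else 0)
  map_univ := by simp
  map_union A B h := by
    have h0 : (0 : ℝ) ∈ A.1 → (0 : ℝ) ∉ B.1 := fun h' => disjoint_left.1 h h'
    have h1 : (1 : ℝ) ∈ A.1 → (1 : ℝ) ∉ B.1 := fun h' => disjoint_left.1 h h'
    by_cases hA0 : (0 : ℝ) ∈ A.1 <;> by_cases hA1 : (1 : ℝ) ∈ A.1 <;>
      by_cases hB0 : (0 : ℝ) ∈ B.1 <;> by_cases hB1 : (1 : ℝ) ∈ B.1 <;>
      simp_all [padd_zero, zero_padd, padd_compl, compl_padd]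
  map_iUnion F hF := by
    have hmono : Monotone fun i => (F i).1 := monotone_nat_of_le_succ hF
    have stab : ∀ r : ℝ, ∃ N, ∀ n, N ≤ n → (r ∈ (F n).1 ↔ r ∈ ⋃ i, (F i).1) := by
      intro r
      by_cases hr : r ∈ ⋃ i, (F i).1
      · obtain ⟨N, hN⟩ := mem_iUnion.1 hr
        exact ⟨N, fun n hn => ⟨fun _ => hr, fun _ => hmono hn hN⟩⟩
      · exact ⟨0, fun n _ => ⟨fun h => mem_iUnion.2 ⟨n, h⟩, fun h => absurd h hr⟩⟩
    obtain ⟨M, hM⟩ := stab 0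
    obtain ⟨N, hN⟩ := stab 1
    constructor
    · rintro _ ⟨i, rfl⟩
      have s0 : (0 : ℝ) ∈ (F i).1 → (0 : ℝ) ∈ ⋃ i, (F i).1 := fun h => mem_iUnion.2 ⟨i, h⟩
      have s1 : (1 : ℝ) ∈ (F i).1 → (1 : ℝ) ∈ ⋃ i, (F i).1 := fun h => mem_iUnion.2 ⟨i, h⟩
      by_cases hA0 : (0 : ℝ) ∈ (F i).1 <;> by_cases hA1 : (1 : ℝ) ∈ (F i).1 <;>
        by_cases hB0 : (0 : ℝ) ∈ ⋃ i, (F i).1 <;> by_cases hB1 : (1 : ℝ) ∈ ⋃ i, (F i).1 <;>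
        simp only [hA0, hA1, hB0, hB1, if_true, if_false, forall_const] at s0 s1 ⊢ <;>
        first
        | exact le_rfl
        | exact zero_le _
        | exact le_one _
    · intro u hu
      have h := hu (mem_range_self (max M N))
      simpa only [hM _ (le_max_left M N), hN _ (le_max_right M N)] using h

end Observable

/-- `𝓔𝓞(E)`: the observables whose spectrum lies in `[0, 1]`, with the Olson order. -/
abbrev EO (E : Type*) [EffectAlgebra E] : Type _ :=
  {x : Observable E // x.spectrum ⊆ Icc (0 : ℝ) 1}

namespace EO

variable {E : Type*} [EffectAlgebra E]

theorem measurable_one_sub : Measurable fun t : ℝ => 1 - t := measurable_const.sub measurable_id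

/-- The negation `x⁻ = f(x)` with `f(t) = 1 - t`. -/
def neg (x : EO E) : EO E :=
  ⟨x.1.map (fun t => 1 - t) measurable_one_sub, by
    intro r hr
    have h : 1 - r ∈ x.1.spectrum := by
      rintro K ⟨hK, hx⟩
      have hc : IsClosed ((fun t : ℝ => 1 - t) ⁻¹' K) :=
        hK.preimage (continuous_const.sub continuous_id)
      refine hr _ ⟨hc, ?_⟩
      rw [← hx]
      change x.1 _ = _
      congr 2
      ext t
      simp
    have := x.2 h
    exact ⟨by linarith [this.2], by linarith [this.1]⟩⟩

/-- The question observable `q_a` as an element of `𝓔𝓞(E)`. -/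
noncomputable def question (a : E) : EO E :=
  ⟨Observable.question a, fun r hr => by
    refine hr (Icc 0 1) ⟨isClosed_Icc, ?_⟩
    simp [Observable.question]⟩

end EO

/-! Apart from the existence of infima, the theorem is formal. Negation is an order-reversing
involution, so suprema are negations of infima. On (0,1] the resolution of `question a` is
constantly a', which reduces statements about questions to E.

The infimum of a family should have as resolution the pointwise supremum F of the resolutions, which
is again monotone and left continuous. The hard point is `exists_observable`: F extends from
half-lines to all Borel sets. The range of F is a chain, so its elements are pairwise compatible and
its bicommutant M is a σ-complete MV-effect algebra with the countable suprema of E.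

In M, values are detected by states. A state h that respects the left continuity of F at the
rationals turns F into a distribution function, hence into a measure μ. An element a is the value at
A (`IsValue`) if μ(A) = h(a) for all h along which countably many prescribed sequences decreasing to
0 vanish. Uniqueness, additivity and continuity come from measure theory once such states separate
points (`exists_generic_state`); existence is a π-λ induction.

Separation is a Rasiowa-Sikorski argument. Countably many requirements are coded in one decreasing
sequence of nonzero elements, and some prime ideal avoids it. The quotient is a chain, and a chain
carries a state, obtained as a rotation number (`nonempty_state_of_linear`). -/

namespace EffectAlgebra

/-! ### Arithmetic and order in an effect algebra -/

section Basic

variable {E : Type*} [EffectAlgebra E]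

theorem compl_compl' (a : E) : aᶜᶜ = a := (eq_compl (compl_padd a)).symm

theorem compl_zero_eq : (0 : E)ᶜ = 1 := (eq_compl (zero_padd 1)).symm

theorem assoc_right {a b c d e : E} (h₁ : padd b c = some d) (h₂ : padd a d = some e) :
    ∃ f, padd a b = some f ∧ padd f c = some e := by
  rw [padd_comm] at h₁ h₂
  obtain ⟨f, hf, hf'⟩ := assoc_left h₁ h₂
  exact ⟨f, by rwa [padd_comm], by rwa [padd_comm]⟩

theorem padd_right_cancel_aux {b c d : E} (h : padd b c = some d) :
    ∃ f, padd c dᶜ = some f ∧ b = fᶜ := by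
  obtain ⟨f, hf, hf'⟩ := assoc_left h (padd_compl d)
  exact ⟨f, hf, eq_compl (by rwa [padd_comm])⟩

theorem padd_right_cancel {a b c d : E} (h₁ : padd a c = some d) (h₂ : padd b c = some d) :
    a = b := by
  obtain ⟨f, hf, rfl⟩ := padd_right_cancel_aux h₁
  obtain ⟨g, hg, rfl⟩ := padd_right_cancel_aux h₂
  rw [hf] at hg
  rw [Option.some.inj hg]

theorem padd_left_cancel {a b c d : E} (h₁ : padd c a = some d) (h₂ : padd c b = some d) :
    a = b := by
  rw [padd_comm] at h₁ h₂
  exact padd_right_cancel h₁ h₂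

theorem le_of_padd_left {a b c : E} (h : padd a b = some c) : a ≤ c := ⟨b, h⟩

theorem le_of_padd_right {a b c : E} (h : padd a b = some c) : b ≤ c :=
  ⟨a, by rwa [padd_comm]⟩

/-- If `a + d = b` then `b' + d = a'`. -/
theorem padd_compl_of_padd {a b d : E} (h : padd a d = some b) : padd bᶜ d = some aᶜ := by
  obtain ⟨f, hf, hf'⟩ := assoc_left h (padd_compl b)
  rw [padd_comm, hf, eq_compl hf']

theorem compl_le_compl' {a b : E} (h : a ≤ b) : bᶜ ≤ aᶜ := by
  obtain ⟨d, hd⟩ := h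
  exact ⟨d, padd_compl_of_padd hd⟩

theorem compl_le_compl_iff {a b : E} : bᶜ ≤ aᶜ ↔ a ≤ b :=
  ⟨fun h => by simpa only [compl_compl'] using compl_le_compl' h, compl_le_compl'⟩

theorem le_compl_comm {a b : E} : a ≤ bᶜ ↔ b ≤ aᶜ := by
  rw [← compl_le_compl_iff, compl_compl']

theorem compl_le_comm {a b : E} : aᶜ ≤ b ↔ bᶜ ≤ a := by
  rw [← compl_le_compl_iff, compl_compl']

theorem le_compl_of_padd {a b c : E} (h : padd a b = some c) : a ≤ bᶜ := by
  obtain ⟨f, hf, hf'⟩ := assoc_left (by rwa [padd_comm] : padd b a = some c) (padd_compl c)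
  exact ⟨_, by rw [hf, eq_compl hf']⟩

theorem exists_padd {a b : E} (h : a ≤ bᶜ) : ∃ c, padd a b = some c := by
  obtain ⟨d, hd⟩ := h
  rw [padd_comm] at hd
  obtain ⟨f, hf, -⟩ := assoc_left hd (compl_padd b)
  exact ⟨f, hf⟩

theorem eq_zero_of_le {a : E} (h : a ≤ 0) : a = 0 := le_antisymm h (zero_le a)

theorem eq_one_of_le {a : E} (h : 1 ≤ a) : a = 1 := le_antisymm (le_one a) h

theorem padd_le_padd_iff {a b c s t : E} (h₁ : padd a b = some s) (h₂ : padd a c = some t) :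
    s ≤ t ↔ b ≤ c := by
  constructor
  · rintro ⟨d, hd⟩
    obtain ⟨f, hf, hf'⟩ := assoc_left h₁ hd
    exact ⟨d, by rw [hf, padd_left_cancel hf' h₂]⟩
  · rintro ⟨d, hd⟩
    obtain ⟨f, hf, hf'⟩ := assoc_right hd h₂
    rw [h₁] at hf
    rw [Option.some.inj hf]
    exact ⟨d, hf'⟩

theorem exists_padd_of_le {a b c s : E} (h : padd a c = some s) (hb : b ≤ c) :
    ∃ t, padd a b = some t ∧ t ≤ s := by
  obtain ⟨d, hd⟩ := hb
  obtain ⟨f, hf, hf'⟩ := assoc_right hd h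
  exact ⟨f, hf, d, hf'⟩

theorem padd_le_padd {a b c d s t : E} (h₁ : padd a b = some s) (h₂ : padd c d = some t)
    (hac : a ≤ c) (hbd : b ≤ d) : s ≤ t := by
  obtain ⟨u, hu, hut⟩ := exists_padd_of_le h₂ hbd
  refine le_trans ?_ hut
  rw [padd_comm] at h₁ hu
  exact (padd_le_padd_iff h₁ hu).2 hac

/-- Translation by `a` preserves suprema of nonempty families. -/
theorem isLUB_padd {ι : Type*} [Nonempty ι] {a y s : E} {f g : ι → E}
    (hf : ∀ i, padd a (f i) = some (g i)) (hy : IsLUB (range f) y) (hs : padd a y = some s) :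
    IsLUB (range g) s := by
  constructor
  · rintro _ ⟨i, rfl⟩
    exact (padd_le_padd_iff (hf i) hs).2 (hy.1 ⟨i, rfl⟩)
  · intro u hu
    obtain ⟨i₀⟩ := ‹Nonempty ι›
    have hau : a ≤ u := (le_of_padd_left (hf i₀)).trans (hu ⟨i₀, rfl⟩)
    obtain ⟨v, hv⟩ := hau
    refine (padd_le_padd_iff hs hv).2 (hy.2 ?_)
    rintro _ ⟨i, rfl⟩
    exact (padd_le_padd_iff (hf i) hv).1 (hu ⟨i, rfl⟩)

theorem isGLB_compl {S : Set E} {a : E} (h : IsLUB S a) : IsGLB (compl '' S) aᶜ := by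
  constructor
  · rintro _ ⟨s, hs, rfl⟩
    exact compl_le_compl' (h.1 hs)
  · intro u hu
    rw [le_compl_comm]
    exact h.2 fun s hs => le_compl_comm.1 (hu ⟨s, hs, rfl⟩)

theorem isLUB_compl {S : Set E} {a : E} (h : IsGLB S a) : IsLUB (compl '' S) aᶜ := by
  constructor
  · rintro _ ⟨s, hs, rfl⟩
    exact compl_le_compl' (h.1 hs)
  · intro u hu
    rw [compl_le_comm]
    exact h.2 fun s hs => compl_le_comm.1 (hu ⟨s, hs, rfl⟩)

/-! ### Compatibility -/

/-- `a` is compatible with `b`: it splits into a part below `b'` and a part below `b`. -/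
def Compat (a b : E) : Prop := ∃ p q, padd p q = some a ∧ p ≤ bᶜ ∧ q ≤ b

theorem compat_of_le {a b : E} (h : a ≤ b) : Compat a b := ⟨0, a, zero_padd a, zero_le _, h⟩

theorem Compat.compl_right {a b : E} (h : Compat a b) : Compat a bᶜ := by
  obtain ⟨p, q, h, hp, hq⟩ := h
  exact ⟨q, p, by rwa [padd_comm], by rwa [compl_compl'], hp⟩

/-- Write a = p + q and b = q + r. As p + b is defined, so is (p + q) + r = a + r, so r ≤ a' and b =
r + q is the required splitting. -/
theorem Compat.symm {a b : E} (h : Compat a b) : Compat b a := by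
  obtain ⟨p, q, h, hp, ⟨r, hr⟩⟩ := h
  obtain ⟨v, hv⟩ := exists_padd hp
  obtain ⟨f, hf, hf'⟩ := assoc_right hr hv
  rw [h] at hf
  obtain rfl := Option.some.inj hf
  exact ⟨r, q, by rwa [padd_comm], le_compl_of_padd (by rwa [padd_comm]), le_of_padd_right h⟩

theorem compat_of_ge {a b : E} (h : b ≤ a) : Compat a b := (compat_of_le h).symm

theorem exists_isLUB_seq (hE : IsSigmaLatticeOrder E) (f : ℕ → E) : ∃ m, IsLUB (range f) m :=
  (hE _ (countable_range f) (range_nonempty f)).2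

/-- Split a = p_s + q_s for each s and put u = sup q_s ≤ b, a = u + v. Then q_s ≤ u gives v ≤ p_s ≤
s' for all s, so v ≤ b'. -/
theorem Compat.isLUB (hE : IsSigmaLatticeOrder E) {a b : E} {S : Set E} (hc : S.Countable)
    (hne : S.Nonempty) (h : ∀ s ∈ S, Compat a s) (hb : IsLUB S b) : Compat a b := by
  choose! p q hpq hp hq using h
  obtain ⟨-, u, hu⟩ := hE (q '' S) (hc.image q) (hne.image q)
  have hua : u ≤ a := hu.2 (by
    rintro _ ⟨s, hs, rfl⟩
    exact le_of_padd_right (hpq s hs))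
  obtain ⟨v, hv⟩ := hua
  refine ⟨v, u, by rwa [padd_comm], ?_, hu.2 ?_⟩
  · rw [le_compl_comm]
    refine hb.2 fun s hs => le_compl_comm.1 (le_trans ?_ (hp s hs))
    obtain ⟨t, ht⟩ := hu.1 ⟨s, hs, rfl⟩
    obtain ⟨f, hf, hf'⟩ := assoc_left ht hv
    have := hpq s hs
    rw [padd_comm] at this
    rw [padd_left_cancel this hf']
    exact le_of_padd_right hf
  · rintro _ ⟨s, hs, rfl⟩
    exact (hq s hs).trans (hb.1 hs)

/-- If `m` is the infimum of compatible elements `a = m + p` and `b`, then `b + p` is their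
supremum. -/
theorem Compat.padd_isLUB {a b m p v : E} (h : Compat a b) (hm : IsGLB {a, b} m)
    (hp : padd m p = some a) (hv : IsLUB {a, b} v) : padd b p = some v := by
  have hmb : m ≤ b := hm.1 (by simp)
  have hpb : p ≤ bᶜ := by
    obtain ⟨p', q', h', hp', hq'⟩ := h
    refine le_trans ?_ hp'
    have hqm : q' ≤ m := hm.2 (by
      rintro _ (rfl | rfl)
      · exact le_of_padd_right h'
      · exact hq')
    obtain ⟨t, ht⟩ := hqm
    obtain ⟨f, hf, hf'⟩ := assoc_left ht hp
    rw [padd_comm] at h'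
    rw [padd_left_cancel h' hf']
    exact le_of_padd_right hf
  obtain ⟨s, hs⟩ := exists_padd hpb
  rw [padd_comm] at hs
  have hvs : v ≤ s := hv.2 (by
    rintro _ (rfl | rfl)
    · exact padd_le_padd hp hs hmb le_rfl
    · exact le_of_padd_left hs)
  -- With v = b + p₀ and p = p₀ + d, the goal becomes d = 0.
  obtain ⟨p₀, hp₀⟩ : b ≤ v := hv.1 (by simp)
  obtain ⟨d, hd⟩ : p₀ ≤ p := (padd_le_padd_iff hp₀ hs).1 hvs
  obtain ⟨r, hr⟩ := hmb
  have hav : a ≤ v := hv.1 (by simp)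
  -- `m + d` lies below both `a` and `b`
  obtain ⟨w, hw, hwa⟩ := exists_padd_of_le hp (le_of_padd_right hd)
  obtain ⟨x, hx, hx'⟩ := assoc_left hr hp₀
  have hpx : p ≤ x := (padd_le_padd_iff hp hx').1 hav
  rw [padd_comm] at hx
  have hdr : d ≤ r := (padd_le_padd_iff hd hx).1 hpx
  have hwm : w ≤ m := hm.2 (by
    rintro _ (rfl | rfl)
    · exact hwa
    · exact padd_le_padd hw hr le_rfl hdr)
  have hd0 : d = 0 := by
    refine eq_zero_of_le ((padd_le_padd_iff hw (padd_zero m)).1 hwm)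
  subst hd0
  rw [padd_zero] at hd
  rwa [← Option.some.inj hd]

/-- Let m = a ∧ b, a = m + p and v = a ∨ b = b + p. Since c is compatible with a and with b ≤ c', it
is compatible with v. So for w = v ∧ c' = b + r and v = w + s one gets s ≤ c. Then p = r + s, and a
= r + (s + m) with r ≤ d' and s + m ≤ c + b = d. -/
theorem Compat.padd (hE : IsSigmaLatticeOrder E) {a b c d : E} (hb : Compat a b)
    (hc : Compat a c) (h : EffectAlgebra.padd b c = some d) : Compat a d := by
  have pair : ∀ x y : E, (∃ m, IsGLB {x, y} m) ∧ ∃ m, IsLUB {x, y} m := fun x y =>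
    hE _ (to_countable _) ⟨x, by simp⟩
  obtain ⟨⟨m, hm⟩, v, hv⟩ := pair a b
  obtain ⟨p, hp⟩ : m ≤ a := hm.1 (by simp)
  have hpv := hb.padd_isLUB hm hp hv
  have hcv : Compat c v := by
    refine Compat.isLUB hE (to_countable _) ⟨a, by simp⟩ ?_ hv
    rintro _ (rfl | rfl)
    · exact hc.symm
    · simpa only [compl_compl'] using (compat_of_le (le_compl_of_padd h)).compl_right.symm
  obtain ⟨⟨w, hw⟩, -⟩ := pair v cᶜ
  obtain ⟨s, hs⟩ : w ≤ v := hw.1 (by simp)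
  obtain ⟨u, hu⟩ := (pair v cᶜ).2
  have hsc : s ≤ c := by
    have := hcv.symm.compl_right.padd_isLUB hw hs hu
    rw [padd_comm] at this
    simpa only [compl_compl'] using le_compl_of_padd this
  obtain ⟨r, hr⟩ : b ≤ w := hw.2 (by
    rintro _ (rfl | rfl)
    · exact hv.1 (by simp)
    · exact le_compl_of_padd h)
  -- `v = b + (r + s)`, so `p = r + s` and `a = r + (s + m)`
  obtain ⟨t, ht, ht'⟩ := assoc_left hr hs
  obtain rfl := padd_left_cancel hpv ht'
  rw [padd_comm] at hp
  obtain ⟨x, hx, hx'⟩ := assoc_left ht hp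
  refine ⟨r, x, hx', ?_, ?_⟩
  · have h2 : EffectAlgebra.padd dᶜ b = some cᶜ := by
      rw [padd_comm] at h
      exact padd_compl_of_padd h
    rw [padd_comm] at h2
    exact (padd_le_padd_iff hr h2).1 (hw.1 (by simp))
  · rw [padd_comm] at hx
    exact padd_le_padd hx h (hm.1 (by simp)) hsc

end Basic

end EffectAlgebra

/-! ### Sub-effect algebras, commutants and bicommutants -/

namespace EffectAlgebra

section Subalgebra

/-- A subset of an effect algebra containing `0` and `1`, closed under complements and defined
sums. -/
structure SubEffectAlgebra (E : Type*) [EffectAlgebra E] where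
  carrier : Set E
  zero_mem : 0 ∈ carrier
  compl_mem : ∀ a ∈ carrier, aᶜ ∈ carrier
  padd_mem : ∀ a ∈ carrier, ∀ b ∈ carrier, ∀ c, padd a b = some c → c ∈ carrier

namespace SubEffectAlgebra

variable {E : Type*} [EffectAlgebra E] (M : SubEffectAlgebra E)

theorem one_mem : (1 : E) ∈ M.carrier := by
  rw [← compl_zero_eq]
  exact M.compl_mem _ M.zero_mem

theorem of_padd_mem {a b c : E} (ha : a ∈ M.carrier) (hc : c ∈ M.carrier)
    (h : padd a b = some c) : b ∈ M.carrier := by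
  have h1 := padd_compl_of_padd (by rwa [padd_comm] at h : padd b a = some c)
  rw [← compl_compl' b]
  exact M.compl_mem _ (M.padd_mem _ (M.compl_mem _ hc) _ ha _ h1)

/-- The elements of a sub-effect algebra, as a type. -/
@[ext]
structure Elem (M : SubEffectAlgebra E) where
  val : E
  property : val ∈ M.carrier

/-- The restriction of the partial sum. -/
def subPadd (a b : M.Elem) : Option M.Elem :=
  (padd a.1 b.1).pmap Elem.mk fun c hc => M.padd_mem a.1 a.2 b.1 b.2 c hc

theorem subPadd_eq_some {a b c : M.Elem} :
    M.subPadd a b = some c ↔ padd a.1 b.1 = some c.1 := by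
  unfold subPadd
  rw [Option.pmap_eq_some_iff]
  constructor
  · rintro ⟨x, hx, h, rfl⟩
    exact h
  · intro h
    exact ⟨c.1, c.2, h, rfl⟩

noncomputable instance : EffectAlgebra M.Elem where
  zero := ⟨0, M.zero_mem⟩
  one := ⟨1, M.one_mem⟩
  padd := M.subPadd
  padd_comm a b := by
    ext c
    rw [M.subPadd_eq_some, M.subPadd_eq_some, EffectAlgebra.padd_comm]
  padd_assoc a b c := by
    ext e
    simp only [Option.bind_eq_some_iff, M.subPadd_eq_some]
    constructor
    · rintro ⟨d, h1, h2⟩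
      obtain ⟨f, hf, hf'⟩ := assoc_left h1 h2
      exact ⟨⟨f, M.padd_mem _ b.2 _ c.2 _ hf⟩, hf, hf'⟩
    · rintro ⟨d, h1, h2⟩
      obtain ⟨f, hf, hf'⟩ := assoc_right h1 h2
      exact ⟨⟨f, M.padd_mem _ a.2 _ b.2 _ hf⟩, hf, hf'⟩
  existsUnique_compl a := by
    refine ⟨⟨a.1ᶜ, M.compl_mem _ a.2⟩, M.subPadd_eq_some.2 (padd_compl _), fun b hb => ?_⟩
    exact Elem.ext (eq_compl (M.subPadd_eq_some.1 hb))
  eq_zero_of_padd_one a h := by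
    obtain ⟨c, hc⟩ := Option.isSome_iff_exists.1 h
    refine Elem.ext (eq_zero_of_padd_one a.1 ?_)
    exact Option.isSome_iff_exists.2 ⟨_, M.subPadd_eq_some.1 hc⟩

theorem padd_eq_some_iff {a b c : M.Elem} :
    padd a b = some c ↔ padd a.1 b.1 = some c.1 := M.subPadd_eq_some

theorem coe_le {a b : M.Elem} : a ≤ b ↔ a.1 ≤ b.1 := by
  constructor
  · rintro ⟨c, hc⟩
    exact ⟨c.1, M.padd_eq_some_iff.1 hc⟩
  · rintro ⟨c, hc⟩
    exact ⟨⟨c, M.of_padd_mem a.2 b.2 hc⟩, M.padd_eq_some_iff.2 hc⟩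

theorem coe_compl (a : M.Elem) : (aᶜ).1 = a.1ᶜ :=
  eq_compl (M.padd_eq_some_iff.1 (padd_compl a))

theorem isLUB_of_coe {S : Set M.Elem} {a : M.Elem} (h : IsLUB (Elem.val '' S) a.1) :
    IsLUB S a := by
  refine ⟨fun s hs => M.coe_le.2 (h.1 ⟨s, hs, rfl⟩), fun u hu => M.coe_le.2 (h.2 ?_)⟩
  rintro _ ⟨s, hs, rfl⟩
  exact M.coe_le.1 (hu hs)

end SubEffectAlgebra

end Subalgebra

section Bicommutant

variable {E : Type*} [EffectAlgebra E]

/-- The elements compatible with every element of `S`, as a sub-effect algebra. -/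
def commutant (hE : IsSigmaLatticeOrder E) (S : Set E) : SubEffectAlgebra E where
  carrier := {a | ∀ s ∈ S, Compat s a}
  zero_mem _ _ := compat_of_ge (zero_le _)
  compl_mem _ h s hs := (h s hs).compl_right
  padd_mem _ ha _ hb _ h s hs := (ha s hs).padd hE (hb s hs) h

theorem isLUB_mem_commutant (hE : IsSigmaLatticeOrder E) (S : Set E) {A : Set E}
    (hA : A.Countable) (hne : A.Nonempty) (hAS : A ⊆ (commutant hE S).carrier) {u : E}
    (hu : IsLUB A u) : u ∈ (commutant hE S).carrier := fun s hs =>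
  Compat.isLUB hE hA hne (fun _ ha => hAS ha s hs) hu

theorem isGLB_mem_commutant (hE : IsSigmaLatticeOrder E) (S : Set E) {A : Set E}
    (hA : A.Countable) (hne : A.Nonempty) (hAS : A ⊆ (commutant hE S).carrier) {u : E}
    (hu : IsGLB A u) : u ∈ (commutant hE S).carrier := by
  rw [← compl_compl' u]
  refine (commutant hE S).compl_mem _ (isLUB_mem_commutant hE S (hA.image _) (hne.image _) ?_
    (isLUB_compl hu))
  rintro _ ⟨a, ha, rfl⟩
  exact (commutant hE S).compl_mem _ (hAS ha)

/-- The bicommutant of `S`. -/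
def bicommutant (hE : IsSigmaLatticeOrder E) (S : Set E) : SubEffectAlgebra E :=
  commutant hE (commutant hE S).carrier

theorem subset_bicommutant (hE : IsSigmaLatticeOrder E) (S : Set E) :
    S ⊆ (bicommutant hE S).carrier := fun _ hs _ ht => (ht _ hs).symm

/-- A pairwise compatible S lies in its commutant, hence so does its bicommutant, whose elements are
compatible with the whole commutant. -/
theorem compat_of_mem_bicommutant (hE : IsSigmaLatticeOrder E) {S : Set E}
    (hS : ∀ a ∈ S, ∀ b ∈ S, Compat a b) {a b : E} (ha : a ∈ (bicommutant hE S).carrier)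
    (hb : b ∈ (bicommutant hE S).carrier) : Compat a b := by
  have ha' : a ∈ (commutant hE S).carrier := fun s hs =>
    ha s fun t ht => hS t ht s hs
  exact hb a ha'

end Bicommutant

/-! ### σ-complete MV-effect algebras and truncated arithmetic -/

/-- An effect algebra that is a `σ`-lattice of pairwise compatible elements, that is, a
`σ`-complete MV-effect algebra. -/
class SigmaMV (E : Type*) [EffectAlgebra E] : Prop where
  sigma : IsSigmaLatticeOrder E
  compat : ∀ a b : E, Compat a b

theorem sigmaMV_bicommutant {E : Type*} [EffectAlgebra E] (hE : IsSigmaLatticeOrder E) {S : Set E}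
    (hS : ∀ a ∈ S, ∀ b ∈ S, Compat a b) : SigmaMV (bicommutant hE S).Elem where
  sigma A hA hne := by
    obtain ⟨⟨m, hm⟩, u, hu⟩ := hE (SubEffectAlgebra.Elem.val '' A) (hA.image _) (hne.image _)
    have hsub : SubEffectAlgebra.Elem.val '' A ⊆ (bicommutant hE S).carrier := by
      rintro _ ⟨a, -, rfl⟩
      exact a.2
    have hm' := isGLB_mem_commutant hE _ (hA.image _) (hne.image _) hsub hm
    have hu' := isLUB_mem_commutant hE _ (hA.image _) (hne.image _) hsub hu
    refine ⟨⟨⟨m, hm'⟩, ?_⟩, ⟨u, hu'⟩, SubEffectAlgebra.isLUB_of_coe _ hu⟩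
    refine ⟨fun s hs => (SubEffectAlgebra.coe_le _).2 (hm.1 ⟨s, hs, rfl⟩),
      fun v hv => (SubEffectAlgebra.coe_le _).2 (hm.2 ?_)⟩
    rintro _ ⟨s, hs, rfl⟩
    exact (SubEffectAlgebra.coe_le _).1 (hv hs)
  compat a b := by
    -- A splitting of a in E need not lie in the bicommutant; the one through m = a ∧ b does.
    obtain ⟨⟨m, hm⟩, v, hv⟩ := hE {a.1, b.1} (to_countable _) ⟨a.1, by simp⟩
    have hmem : m ∈ (bicommutant hE S).carrier :=
      isGLB_mem_commutant hE _ (to_countable _) ⟨a.1, by simp⟩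
        (by rintro _ (rfl | rfl); exacts [a.2, b.2]) hm
    obtain ⟨p, hp⟩ : m ≤ a.1 := hm.1 (by simp)
    have hpmem := SubEffectAlgebra.of_padd_mem _ hmem a.2 hp
    have h := (compat_of_mem_bicommutant hE hS a.2 b.2).padd_isLUB hm hp hv
    refine ⟨⟨p, hpmem⟩, ⟨m, hmem⟩, ?_, ?_, ?_⟩
    · rw [SubEffectAlgebra.padd_eq_some_iff, padd_comm]
      exact hp
    · rw [SubEffectAlgebra.coe_le, SubEffectAlgebra.coe_compl]
      rw [padd_comm] at h
      exact le_compl_of_padd h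
    · exact (SubEffectAlgebra.coe_le _).2 (hm.1 (by simp))

theorem isLUB_coe_bicommutant {E : Type*} [EffectAlgebra E] (hE : IsSigmaLatticeOrder E)
    {S : Set E} {A : Set (bicommutant hE S).Elem} (hA : A.Countable) (hne : A.Nonempty)
    {u : (bicommutant hE S).Elem} (hu : IsLUB A u) :
    IsLUB (SubEffectAlgebra.Elem.val '' A) u.1 := by
  obtain ⟨v, hv⟩ := (hE (SubEffectAlgebra.Elem.val '' A) (hA.image _) (hne.image _)).2
  have hv' : v ∈ (bicommutant hE S).carrier :=
    isLUB_mem_commutant hE _ (hA.image _) (hne.image _) (by rintro _ ⟨a, -, rfl⟩; exact a.2) hv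
  have : u = ⟨v, hv'⟩ := hu.unique (SubEffectAlgebra.isLUB_of_coe _ hv)
  rw [this]
  exact hv

namespace SigmaMV

variable {E : Type*} [EffectAlgebra E] [SigmaMV E]

theorem exists_pair (a b : E) : (∃ m, IsGLB {a, b} m) ∧ ∃ m, IsLUB {a, b} m :=
  sigma _ (to_countable _) ⟨a, by simp⟩

noncomputable instance : Lattice E where
  __ := EffectAlgebra.instPartialOrder
  inf a b := (exists_pair a b).1.choose
  sup a b := (exists_pair a b).2.choose
  inf_le_left a b := (exists_pair a b).1.choose_spec.1 (by simp)
  inf_le_right a b := (exists_pair a b).1.choose_spec.1 (by simp)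
  le_inf a b c h₁ h₂ := (exists_pair b c).1.choose_spec.2 (by
    rintro _ (rfl | rfl)
    exacts [h₁, h₂])
  le_sup_left a b := (exists_pair a b).2.choose_spec.1 (by simp)
  le_sup_right a b := (exists_pair a b).2.choose_spec.1 (by simp)
  sup_le a b c h₁ h₂ := (exists_pair a b).2.choose_spec.2 (by
    rintro _ (rfl | rfl)
    exacts [h₁, h₂])

/-- The truncated difference `a ∸ b`. -/
noncomputable def tsub (a b : E) : E := (inf_le_left : a ⊓ b ≤ a).choose

theorem inf_padd_tsub (a b : E) : padd (a ⊓ b) (tsub a b) = some a :=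
  (inf_le_left : a ⊓ b ≤ a).choose_spec

theorem padd_tsub (a b : E) : padd b (tsub a b) = some (a ⊔ b) :=
  (compat a b).padd_isLUB isGLB_pair (inf_padd_tsub a b) isLUB_pair

theorem tsub_le (a b : E) : tsub a b ≤ a := le_of_padd_right (inf_padd_tsub a b)

theorem tsub_le_compl (a b : E) : tsub a b ≤ bᶜ :=
  le_compl_comm.1 (le_compl_of_padd (padd_tsub a b))

theorem tsub_eq_zero {a b : E} : tsub a b = 0 ↔ a ≤ b := by
  have h := padd_tsub a b
  constructor
  · intro h0
    rw [h0, padd_zero] at h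
    exact sup_eq_right.1 (Option.some.inj h).symm
  · intro hab
    rw [sup_eq_right.2 hab] at h
    exact padd_left_cancel h (padd_zero b)

theorem tsub_zero (a : E) : tsub a 0 = a := by
  have h := padd_tsub a 0
  rw [zero_padd, sup_eq_left.2 (zero_le a)] at h
  exact Option.some.inj h

theorem tsub_eq_self {a b : E} (h : a ⊓ b = 0) : tsub a b = a := by
  have := inf_padd_tsub a b
  rw [h, zero_padd] at this
  exact Option.some.inj this

theorem inf_compl (a b : E) : aᶜ ⊓ bᶜ = (a ⊔ b)ᶜ := by
  apply le_antisymm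
  · rw [le_compl_comm]
    exact sup_le (le_compl_comm.1 inf_le_left) (le_compl_comm.1 inf_le_right)
  · exact le_inf (compl_le_compl' le_sup_left) (compl_le_compl' le_sup_right)

theorem compl_tsub_compl (a b : E) : tsub bᶜ aᶜ = tsub a b := by
  have h := inf_padd_tsub bᶜ aᶜ
  rw [inf_compl, sup_comm] at h
  exact padd_left_cancel h (padd_compl_of_padd (padd_tsub a b))

/-- The truncated sum. -/
noncomputable def tadd (a b : E) : E := (tsub aᶜ b)ᶜ

theorem tadd_comm (a b : E) : tadd a b = tadd b a := by
  unfold tadd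
  rw [← compl_tsub_compl, compl_compl']

theorem padd_inf_compl (a b : E) : padd a (aᶜ ⊓ b) = some (tadd a b) := by
  have h := padd_compl_of_padd (inf_padd_tsub aᶜ b)
  have h2 := inf_padd_tsub aᶜ b
  obtain ⟨f, hf, hf'⟩ := assoc_right h2 (padd_compl a)
  rw [hf]
  rw [padd_comm] at hf'
  have := eq_compl hf'
  rw [this]
  rfl

theorem tadd_eq_of_padd {a b c : E} (h : padd a b = some c) : tadd a b = c := by
  have h' := padd_inf_compl a b
  rw [inf_eq_right.2 (le_compl_comm.1 (le_compl_of_padd h)), h] at h'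
  exact (Option.some.inj h').symm

theorem left_le_tadd (a b : E) : a ≤ tadd a b := le_of_padd_left (padd_inf_compl a b)

theorem right_le_tadd (a b : E) : b ≤ tadd a b := tadd_comm b a ▸ left_le_tadd b a

/-- Compare the summands in b + (a ∸ b) = a ∨ b and b + (b' ∧ c) = b ⊕ c. Most rules for truncated
operations follow from this adjunction. -/
theorem tsub_le_iff {a b c : E} : tsub a b ≤ c ↔ a ≤ tadd b c := by
  constructor
  · intro h
    exact le_sup_left.trans ((padd_le_padd_iff (padd_tsub a b) (padd_inf_compl b c)).2
      (le_inf (tsub_le_compl a b) h))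
  · intro h
    exact ((padd_le_padd_iff (padd_tsub a b) (padd_inf_compl b c)).1
      (sup_le h (left_le_tadd b c))).trans inf_le_right

theorem padd_sup {a b c s t : E} (hs : padd a b = some s) (ht : padd a c = some t) :
    padd a (b ⊔ c) = some (s ⊔ t) := by
  obtain ⟨d, hd⟩ : a ≤ s ⊔ t := (le_of_padd_left hs).trans le_sup_left
  have hbd : b ⊔ c ≤ d := sup_le ((padd_le_padd_iff hs hd).1 le_sup_left)
    ((padd_le_padd_iff ht hd).1 le_sup_right)
  obtain ⟨u, hu, hu'⟩ := exists_padd_of_le hd hbd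
  have : s ⊔ t ≤ u := sup_le ((padd_le_padd_iff hs hu).2 le_sup_left)
    ((padd_le_padd_iff ht hu).2 le_sup_right)
  rw [hu, le_antisymm hu' this]

/-- Let w = b' ∧ c, so b + w = b ⊕ c. Translation by b preserves joins, so b + ((a ∸ b) ∨ w) = a ∨
(b ⊕ c); cancelling b + w gives (a ∸ b) ∸ w. Here w may be replaced by c because a ∸ b ≤ b'. -/
theorem tsub_tadd (a b c : E) : tsub a (tadd b c) = tsub (tsub a b) c := by
  have hw := padd_inf_compl b c
  set w := bᶜ ⊓ c with hwdef
  have h1 := padd_sup (padd_tsub a b) hw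
  have h2 := padd_tsub a (tadd b c)
  have hs : a ⊔ b ⊔ tadd b c = a ⊔ tadd b c := by
    rw [sup_assoc, sup_eq_right.2 (left_le_tadd b c)]
  rw [hs] at h1
  obtain ⟨f, hf, hf'⟩ := assoc_left hw h2
  obtain rfl := padd_left_cancel h1 hf'
  have h3 := padd_left_cancel hf (padd_tsub (tsub a b) w)
  rw [h3]
  have h4 := inf_padd_tsub (tsub a b) w
  rw [hwdef, ← inf_assoc, inf_eq_left.2 (tsub_le_compl a b), ← hwdef] at h4
  exact padd_left_cancel h4 (inf_padd_tsub _ _)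

theorem tadd_assoc (a b c : E) : tadd (tadd a b) c = tadd a (tadd b c) := by
  refine eq_of_forall_le_iff fun d => ?_
  rw [← tsub_le_iff, ← tsub_le_iff, ← tsub_le_iff, tsub_tadd]

theorem tadd_le_tadd {a b c d : E} (h₁ : a ≤ c) (h₂ : b ≤ d) : tadd a b ≤ tadd c d := by
  have key : ∀ x y z : E, y ≤ z → tadd x y ≤ tadd x z := fun x y z h =>
    tsub_le_iff.1 ((tsub_le_iff.2 le_rfl).trans h)
  exact (key a b d h₂).trans (by rw [tadd_comm a, tadd_comm c]; exact key d a c h₁)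

theorem le_tadd_tsub (a b : E) : a ≤ tadd b (tsub a b) := tsub_le_iff.1 le_rfl

theorem tadd_zero (a : E) : tadd a 0 = a := tadd_eq_of_padd (padd_zero a)

theorem tsub_le_tsub {a b c d : E} (h₁ : a ≤ c) (h₂ : d ≤ b) : tsub a b ≤ tsub c d := by
  rw [tsub_le_iff]
  exact h₁.trans ((le_tadd_tsub c d).trans (tadd_le_tadd h₂ le_rfl))

/-- The triangle inequality for truncated differences. -/
theorem tsub_le_tadd_tsub (a b c : E) : tsub a c ≤ tadd (tsub a b) (tsub b c) := by
  rw [tsub_le_iff]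
  calc a ≤ tadd b (tsub a b) := le_tadd_tsub a b
    _ ≤ tadd (tadd c (tsub b c)) (tsub a b) := tadd_le_tadd (le_tadd_tsub b c) le_rfl
    _ = _ := by rw [tadd_assoc, tadd_comm (tsub b c)]

theorem tadd_tsub_tadd_le (a b c : E) : tsub (tadd a c) (tadd b c) ≤ tsub a b := by
  rw [tsub_le_iff]
  calc tadd a c ≤ tadd (tadd b (tsub a b)) c := tadd_le_tadd (le_tadd_tsub a b) le_rfl
    _ = _ := by rw [tadd_assoc, tadd_assoc, tadd_comm c]

/-- Adding this meet to a ∧ b stays below both a and b, hence below a ∧ b, so the meet is 0. -/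
theorem tsub_inf_tsub (a b : E) : tsub a b ⊓ tsub b a = 0 := by
  set w := tsub a b ⊓ tsub b a
  obtain ⟨s, hs, hsa⟩ := exists_padd_of_le (inf_padd_tsub a b) (inf_le_left : w ≤ _)
  have hb := inf_padd_tsub b a
  rw [inf_comm] at hb
  obtain ⟨t, ht, htb⟩ := exists_padd_of_le hb (inf_le_right : w ≤ _)
  rw [hs] at ht
  obtain rfl := Option.some.inj ht
  exact eq_zero_of_le ((padd_le_padd_iff hs (padd_zero _)).1 (le_inf hsa htb))

theorem inf_tadd_eq_zero {a b c : E} (hb : a ⊓ b = 0) (hc : a ⊓ c = 0) : a ⊓ tadd b c = 0 := by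
  set w := a ⊓ tadd b c with hw
  have hwa : w ≤ a := inf_le_left
  have h1 : w ⊓ b = 0 := eq_zero_of_le (hb ▸ inf_le_inf_right b hwa)
  have h2 : w ≤ c := by
    have : tsub w b ≤ c := tsub_le_iff.2 inf_le_right
    rwa [tsub_eq_self h1] at this
  exact eq_zero_of_le (hc ▸ le_inf hwa h2)

/-- The truncated multiple `n · a`. -/
noncomputable def tmul (a : E) : ℕ → E
  | 0 => 0
  | n + 1 => tadd (tmul a n) a

theorem inf_tmul_eq_zero {a b : E} (h : a ⊓ b = 0) (n : ℕ) : a ⊓ tmul b n = 0 := by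
  induction n with
  | zero => exact eq_zero_of_le inf_le_right
  | succ n ih => exact inf_tadd_eq_zero ih h

theorem tmul_add (a : E) (m n : ℕ) : tmul a (m + n) = tadd (tmul a m) (tmul a n) := by
  induction n with
  | zero => exact (tadd_zero _).symm
  | succ n ih =>
    change tadd (tmul a (m + n)) a = tadd (tmul a m) (tadd (tmul a n) a)
    rw [ih, tadd_assoc]

/-- The Archimedean property. -/
theorem exists_tmul_not_le {c : E} (hc : c ≠ 0) : ∃ k, ¬ tmul c k ≤ cᶜ := by
  by_contra! h
  obtain ⟨s, hs⟩ := exists_isLUB_seq sigma (tmul c)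
  have hsc : s ≤ cᶜ := hs.2 (by
    rintro _ ⟨k, rfl⟩
    exact h k)
  obtain ⟨t, ht⟩ := exists_padd hsc
  have hstep : ∀ k, padd c (tmul c k) = some (tmul c (k + 1)) := fun k => by
    obtain ⟨u, hu⟩ := exists_padd (h k)
    rw [padd_comm, hu]
    exact congrArg some (tadd_eq_of_padd hu).symm
  rw [padd_comm] at ht
  -- Translating the supremum s of the multiples by c gives the supremum of the multiples from the
  -- first on, so c + s ≤ s and c = 0.
  have hlub := isLUB_padd hstep hs ht
  have hts : t ≤ s := hlub.2 (by
    rintro _ ⟨k, rfl⟩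
    exact hs.1 ⟨k + 1, rfl⟩)
  rw [padd_comm] at ht
  exact hc (eq_zero_of_le ((padd_le_padd_iff ht (padd_zero s)).1 hts))

end SigmaMV

end EffectAlgebra

/-! ### Prime ideals and quotients -/

namespace EffectAlgebra

/-- An ideal of a `σ`-complete MV-effect algebra. -/
structure MVIdeal (E : Type*) [EffectAlgebra E] [SigmaMV E] where
  carrier : Set E
  zero_mem : 0 ∈ carrier
  mem_of_le : ∀ a b, a ≤ b → b ∈ carrier → a ∈ carrier
  tadd_mem : ∀ a ∈ carrier, ∀ b ∈ carrier, SigmaMV.tadd a b ∈ carrier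

namespace MVIdeal

open SigmaMV

variable {E : Type*} [EffectAlgebra E] [SigmaMV E]

/-- An ideal is prime if the quotient by it is totally ordered. -/
def IsPrime (P : MVIdeal E) : Prop := ∀ a b, tsub a b ∈ P.carrier ∨ tsub b a ∈ P.carrier

/-- The ideal generated by `P` and `x`. -/
def adjoin (P : MVIdeal E) (x : E) : MVIdeal E where
  carrier := {z | ∃ n, ∃ p ∈ P.carrier, z ≤ tadd (tmul x n) p}
  zero_mem := ⟨0, 0, P.zero_mem, zero_le _⟩
  mem_of_le := by
    rintro a b hab ⟨n, p, hp, h⟩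
    exact ⟨n, p, hp, hab.trans h⟩
  tadd_mem := by
    rintro a ⟨n, p, hp, ha⟩ b ⟨m, q, hq, hb⟩
    refine ⟨n + m, tadd p q, P.tadd_mem _ hp _ hq, (tadd_le_tadd ha hb).trans_eq ?_⟩
    rw [tmul_add, tadd_assoc, tadd_assoc, ← tadd_assoc p, tadd_comm p, tadd_assoc (tmul x m)]

theorem subset_adjoin (P : MVIdeal E) (x : E) : P.carrier ⊆ (P.adjoin x).carrier :=
  fun p hp => ⟨0, p, hp, right_le_tadd _ _⟩

theorem mem_adjoin (P : MVIdeal E) (x : E) : x ∈ (P.adjoin x).carrier :=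
  ⟨1, 0, P.zero_mem, (right_le_tadd _ _).trans (left_le_tadd _ _)⟩

/-- There is a prime ideal avoiding a given decreasing sequence of nonzero elements. -/
theorem exists_isPrime_avoiding {b : ℕ → E} (hb : Antitone b) (h0 : ∀ i, b i ≠ 0) :
    ∃ P : MVIdeal E, P.IsPrime ∧ ∀ i, b i ∉ P.carrier := by
  let 𝒮 : Set (Set E) := {I | ∃ P : MVIdeal E, P.carrier = I ∧ ∀ i, b i ∉ I}
  obtain ⟨m, hm⟩ : ∃ m, Maximal (· ∈ 𝒮) m := by
    refine zorn_subset 𝒮 fun c hc hchain => ?_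
    -- The empty chain is bounded by the zero ideal, which avoids all b i since they are nonzero.
    rcases c.eq_empty_or_nonempty with rfl | ⟨I₀, hI₀⟩
    · exact ⟨{0}, ⟨⟨{0}, rfl, fun a b hab hb => eq_zero_of_le (hab.trans_eq hb),
        fun a ha b hb => by
          rw [mem_singleton_iff] at *
          rw [ha, hb, tadd_zero]⟩, rfl, h0⟩, fun s hs => hs.elim⟩
    · refine ⟨⋃₀ c, ⟨⟨⋃₀ c, ?_, ?_, ?_⟩, rfl, ?_⟩, fun s hs => subset_sUnion_of_mem hs⟩
      · obtain ⟨P, rfl, -⟩ := hc hI₀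
        exact ⟨_, hI₀, P.zero_mem⟩
      · rintro x y hxy ⟨I, hI, hy⟩
        obtain ⟨P, rfl, -⟩ := hc hI
        exact ⟨_, hI, P.mem_of_le _ _ hxy hy⟩
      · rintro x ⟨I, hI, hx⟩ y ⟨J, hJ, hy⟩
        rcases hchain.total hI hJ with h | h
        · obtain ⟨P, rfl, -⟩ := hc hJ
          exact ⟨_, hJ, P.tadd_mem _ (h hx) _ hy⟩
        · obtain ⟨P, rfl, -⟩ := hc hI
          exact ⟨_, hI, P.tadd_mem _ hx _ (h hy)⟩
      · rintro i ⟨I, hI, hi⟩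
        obtain ⟨P, rfl, hP⟩ := hc hI
        exact hP i hi
  obtain ⟨⟨P, rfl, hP⟩, hmax⟩ := hm
  refine ⟨P, ?_, hP⟩
  have hgen : ∀ x ∉ P.carrier, ∃ i, b i ∈ (P.adjoin x).carrier := by
    intro x hx
    by_contra! h
    exact hx (hmax ⟨P.adjoin x, rfl, h⟩ (P.subset_adjoin x) (P.mem_adjoin x))
  -- If x ∸ y and y ∸ x both lie outside P, adjoining either one captures some b i. As b decreases,
  -- one b k lies below n(x ∸ y) ⊕ p and below m(y ∸ x) ⊕ q. Multiples of disjoint elements are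
  -- disjoint, so b k ≤ p ⊕ q, which is in P.
  intro x y
  by_contra! h
  obtain ⟨i, n, p, hp, hi⟩ := hgen _ h.1
  obtain ⟨j, m, q, hq, hj⟩ := hgen _ h.2
  set k := max i j
  have hpq := P.tadd_mem _ hp _ hq
  refine hP k (P.mem_of_le _ _ ?_ hpq)
  have h1 : tsub (b k) (tadd p q) ≤ tmul (tsub x y) n := by
    rw [tsub_le_iff, tadd_comm]
    exact (hb (le_max_left i j)).trans (hi.trans (tadd_le_tadd le_rfl (left_le_tadd _ _)))
  have h2 : tsub (b k) (tadd p q) ≤ tmul (tsub y x) m := by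
    rw [tsub_le_iff, tadd_comm]
    exact (hb (le_max_right i j)).trans (hj.trans (tadd_le_tadd le_rfl (right_le_tadd _ _)))
  have h3 : tmul (tsub x y) n ⊓ tmul (tsub y x) m = 0 := by
    refine inf_tmul_eq_zero ?_ m
    rw [inf_comm]
    refine inf_tmul_eq_zero ?_ n
    rw [inf_comm]
    exact tsub_inf_tsub x y
  rw [← tsub_eq_zero]
  exact eq_zero_of_le (h3 ▸ le_inf h1 h2)

variable (P : MVIdeal E)

/-- Congruence modulo an ideal. -/
def setoid : Setoid E where
  r a b := tsub a b ∈ P.carrier ∧ tsub b a ∈ P.carrier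
  iseqv :=
    { refl := fun a => by
        rw [tsub_eq_zero.2 (le_refl a)]
        exact ⟨P.zero_mem, P.zero_mem⟩
      symm := fun h => ⟨h.2, h.1⟩
      trans := fun h₁ h₂ =>
        ⟨P.mem_of_le _ _ (tsub_le_tadd_tsub _ _ _) (P.tadd_mem _ h₁.1 _ h₂.1),
          P.mem_of_le _ _ (tsub_le_tadd_tsub _ _ _) (P.tadd_mem _ h₂.2 _ h₁.2)⟩ }

/-- The quotient by an ideal. -/
def Quot : Type _ := Quotient P.setoid

/-- The quotient map. -/
def proj (a : E) : P.Quot := Quotient.mk P.setoid a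

theorem proj_eq {a b : E} : P.proj a = P.proj b ↔ tsub a b ∈ P.carrier ∧ tsub b a ∈ P.carrier :=
  Quotient.eq (r := P.setoid)

theorem proj_tadd_congr {a b c : E} (h : P.proj a = P.proj b) :
    P.proj (tadd a c) = P.proj (tadd b c) := by
  rw [proj_eq] at *
  exact ⟨P.mem_of_le _ _ (tadd_tsub_tadd_le _ _ _) h.1,
    P.mem_of_le _ _ (tadd_tsub_tadd_le _ _ _) h.2⟩

theorem proj_tadd_congr₂ {a b c d : E} (h : P.proj a = P.proj b) (h' : P.proj c = P.proj d) :
    P.proj (tadd a c) = P.proj (tadd b d) := by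
  rw [P.proj_tadd_congr h, tadd_comm, P.proj_tadd_congr h', tadd_comm]

theorem tsub_mem_of_proj_eq {a b c d : E} (h : P.proj a = P.proj b) (h' : P.proj c = P.proj d)
    (hab : tsub a c ∈ P.carrier) : tsub b d ∈ P.carrier := by
  rw [proj_eq] at h h'
  exact P.mem_of_le _ _ (tsub_le_tadd_tsub _ a _) (P.tadd_mem _ h.2 _
    (P.mem_of_le _ _ (tsub_le_tadd_tsub _ c _) (P.tadd_mem _ hab _ h'.1)))

theorem proj_compl_congr {a b : E} (h : P.proj a = P.proj b) : P.proj aᶜ = P.proj bᶜ := by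
  rw [proj_eq] at *
  rw [compl_tsub_compl, compl_tsub_compl]
  exact h.symm

open Classical in
/-- The partial sum on the quotient. -/
noncomputable def quotPadd : P.Quot → P.Quot → Option P.Quot :=
  Quotient.lift₂ (s₁ := P.setoid) (s₂ := P.setoid)
    (fun a b => if tsub a bᶜ ∈ P.carrier then some (P.proj (tadd a b)) else none) (by
      intro a b c d hac hbd
      replace hac : P.proj a = P.proj c := Quotient.sound hac
      replace hbd : P.proj b = P.proj d := Quotient.sound hbd
      have hiff : tsub a bᶜ ∈ P.carrier ↔ tsub c dᶜ ∈ P.carrier :=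
        ⟨P.tsub_mem_of_proj_eq hac (P.proj_compl_congr hbd),
          P.tsub_mem_of_proj_eq hac.symm (P.proj_compl_congr hbd.symm)⟩
      simp only [hiff, P.proj_tadd_congr₂ hac hbd])

theorem quotPadd_proj_eq_some {a b : E} {x : P.Quot} :
    P.quotPadd (P.proj a) (P.proj b) = some x ↔ tsub a bᶜ ∈ P.carrier ∧ P.proj (tadd a b) = x := by
  classical
  change (if tsub a bᶜ ∈ P.carrier then some (P.proj (tadd a b)) else none) = some x ↔ _
  split_ifs with h <;> simp [h]

theorem tsub_compl_comm (a b : E) : tsub a bᶜ = tsub b aᶜ := by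
  rw [← compl_tsub_compl, compl_compl']

/-- In group notation: `(t + u - 1)⁺ ≤ (t + a - 1)⁺ + (min(t + a, 1) + b - 1)⁺` for
`u = min(a + b, 1)`. -/
theorem tsub_compl_tadd_le (t a b : E) :
    tsub t (tadd a b)ᶜ ≤ tadd (tsub t aᶜ) (tsub (tadd t a) bᶜ) := by
  rw [tsub_compl_comm t, tsub_compl_comm t, tsub_compl_comm (tadd t a), tsub_le_iff, ← tadd_assoc]
  have h1 : tadd tᶜ (tsub a tᶜ) = tadd a (tsub tᶜ a) := by
    rw [tadd_eq_of_padd (padd_tsub a tᶜ), tadd_eq_of_padd (padd_tsub tᶜ a), sup_comm]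
  have h2 : (tadd t a)ᶜ = tsub tᶜ a := compl_compl' _
  rw [h1, h2, tadd_assoc]
  exact tadd_le_tadd le_rfl (le_tadd_tsub _ _)

/-- The two sides say that (t + a) + b and t + (a + b) are defined modulo P. The converse is the
forward direction for the reversed triple b, a, t. -/
theorem quot_assoc_iff (t a b : E) :
    (tsub t aᶜ ∈ P.carrier ∧ tsub (tadd t a) bᶜ ∈ P.carrier) ↔
      (tsub a bᶜ ∈ P.carrier ∧ tsub t (tadd a b)ᶜ ∈ P.carrier) := by
  have key : ∀ t a b : E, tsub t aᶜ ∈ P.carrier ∧ tsub (tadd t a) bᶜ ∈ P.carrier →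
      tsub a bᶜ ∈ P.carrier ∧ tsub t (tadd a b)ᶜ ∈ P.carrier := fun t a b ⟨h1, h2⟩ =>
    ⟨P.mem_of_le _ _ (tsub_le_tsub (right_le_tadd t a) le_rfl) h2,
      P.mem_of_le _ _ (tsub_compl_tadd_le t a b) (P.tadd_mem _ h1 _ h2)⟩
  refine ⟨key t a b, fun h => ?_⟩
  have := key b a t ⟨by rw [tsub_compl_comm]; exact h.1, by
    rw [tsub_compl_comm, tadd_comm b]; exact h.2⟩
  exact ⟨by rw [tsub_compl_comm]; exact this.1, by
    rw [tsub_compl_comm, tadd_comm t]; exact this.2⟩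

theorem quotPadd_comm (x y : P.Quot) : P.quotPadd x y = P.quotPadd y x := by
  induction x using Quotient.inductionOn with | _ a
  induction y using Quotient.inductionOn with | _ b
  change P.quotPadd (P.proj a) (P.proj b) = P.quotPadd (P.proj b) (P.proj a)
  ext z
  rw [quotPadd_proj_eq_some, quotPadd_proj_eq_some, tsub_compl_comm, tadd_comm]

theorem quotPadd_assoc (x y z : P.Quot) :
    ((P.quotPadd x y).bind fun d => P.quotPadd d z) =
      (P.quotPadd y z).bind fun d => P.quotPadd x d := by
  induction x using Quotient.inductionOn with | _ a
  induction y using Quotient.inductionOn with | _ b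
  induction z using Quotient.inductionOn with | _ c
  change ((P.quotPadd (P.proj a) (P.proj b)).bind fun d => P.quotPadd d (P.proj c)) =
      (P.quotPadd (P.proj b) (P.proj c)).bind fun d => P.quotPadd (P.proj a) d
  ext w
  simp only [Option.bind_eq_some_iff, quotPadd_proj_eq_some]
  constructor
  · rintro ⟨d, ⟨h1, rfl⟩, h2⟩
    rw [quotPadd_proj_eq_some] at h2
    have h := (P.quot_assoc_iff a b c).1 ⟨h1, h2.1⟩
    refine ⟨_, ⟨h.1, rfl⟩, ?_⟩
    rw [quotPadd_proj_eq_some]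
    exact ⟨h.2, by rw [← tadd_assoc]; exact h2.2⟩
  · rintro ⟨d, ⟨h1, rfl⟩, h2⟩
    rw [quotPadd_proj_eq_some] at h2
    have h := (P.quot_assoc_iff a b c).2 ⟨h1, h2.1⟩
    refine ⟨_, ⟨h.1, rfl⟩, ?_⟩
    rw [quotPadd_proj_eq_some]
    exact ⟨h.2, by rw [tadd_assoc]; exact h2.2⟩

noncomputable instance : EffectAlgebra P.Quot where
  zero := P.proj 0
  one := P.proj 1
  padd := P.quotPadd
  padd_comm := P.quotPadd_comm
  padd_assoc := P.quotPadd_assoc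
  existsUnique_compl x := by
    induction x using Quotient.inductionOn with | _ a
    refine ⟨P.proj aᶜ, ?_, fun y hy => ?_⟩
    · change P.quotPadd (P.proj a) (P.proj aᶜ) = some (P.proj 1)
      rw [quotPadd_proj_eq_some, compl_compl', tsub_eq_zero.2 le_rfl,
        tadd_eq_of_padd (padd_compl a)]
      exact ⟨P.zero_mem, rfl⟩
    · induction y using Quotient.inductionOn with | _ b
      change P.quotPadd (P.proj a) (P.proj b) = some (P.proj 1) at hy
      change P.proj b = P.proj aᶜ
      rw [quotPadd_proj_eq_some, proj_eq] at hy
      rw [proj_eq, tsub_compl_comm]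
      refine ⟨hy.1, ?_⟩
      have h := hy.2.2
      rwa [← compl_tsub_compl, compl_one_eq, SigmaMV.tsub_zero, tadd, compl_compl'] at h
  eq_zero_of_padd_one x h := by
    induction x using Quotient.inductionOn with | _ a
    obtain ⟨y, hy⟩ := Option.isSome_iff_exists.1 h
    change P.quotPadd (P.proj a) (P.proj 1) = some y at hy
    change P.proj a = P.proj 0
    rw [quotPadd_proj_eq_some, compl_one_eq, SigmaMV.tsub_zero] at hy
    rw [proj_eq, SigmaMV.tsub_zero, tsub_eq_zero.2 (zero_le a)]
    exact ⟨hy.1, P.zero_mem⟩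

theorem padd_proj {a b c : E} (h : padd a b = some c) :
    padd (P.proj a) (P.proj b) = some (P.proj c) := by
  change P.quotPadd _ _ = _
  rw [quotPadd_proj_eq_some, tsub_eq_zero.2 (le_compl_of_padd h), tadd_eq_of_padd h]
  exact ⟨P.zero_mem, rfl⟩

theorem proj_le_of_tsub_mem {a b : E} (h : tsub a b ∈ P.carrier) : P.proj a ≤ P.proj b := by
  refine ⟨P.proj (tsub b a), ?_⟩
  rw [P.padd_proj (padd_tsub b a)]
  congr 1
  rw [proj_eq, tsub_eq_zero.2 (le_sup_left : b ≤ b ⊔ a)]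
  refine ⟨P.mem_of_le _ _ ?_ h, P.zero_mem⟩
  rw [tsub_le_iff]
  exact sup_le (left_le_tadd _ _) (le_tadd_tsub _ _)

theorem quot_le_total (hP : P.IsPrime) (x y : P.Quot) : x ≤ y ∨ y ≤ x := by
  induction x using Quotient.inductionOn with | _ a
  induction y using Quotient.inductionOn with | _ b
  exact (hP a b).imp P.proj_le_of_tsub_mem P.proj_le_of_tsub_mem

theorem proj_eq_zero {a : E} (h : a ∈ P.carrier) : P.proj a = 0 := by
  change P.proj a = P.proj 0
  rw [proj_eq, SigmaMV.tsub_zero, tsub_eq_zero.2 (zero_le a)]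
  exact ⟨h, P.zero_mem⟩

end MVIdeal

end EffectAlgebra

/-! ### States, and their existence on chains -/

open Filter Topology

namespace EffectAlgebra

/-- A state of an effect algebra. -/
structure State (E : Type*) [EffectAlgebra E] where
  toFun : E → ℝ
  nonneg : ∀ a, 0 ≤ toFun a
  map_one : toFun 1 = 1
  map_padd : ∀ a b c, padd a b = some c → toFun c = toFun a + toFun b

namespace State

variable {E : Type*} [EffectAlgebra E] (h : State E)

theorem map_zero : h.toFun 0 = 0 := by
  have := h.map_padd 0 0 0 (padd_zero 0)
  linarith

theorem mono {a b : E} (hab : a ≤ b) : h.toFun a ≤ h.toFun b := by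
  obtain ⟨c, hc⟩ := hab
  rw [h.map_padd a c b hc]
  linarith [h.nonneg c]

theorem map_compl (a : E) : h.toFun aᶜ = 1 - h.toFun a := by
  have := h.map_padd _ _ _ (padd_compl a)
  rw [h.map_one] at this
  linarith

theorem le_one (a : E) : h.toFun a ≤ 1 := by
  rw [← h.map_one]
  exact h.mono (EffectAlgebra.le_one a)

end State

section Linear

variable {E : Type*} [EffectAlgebra E]

open Classical in
/-- Translation by `a` on the unrolled chain `ℕ ×ₗ E`, in which `(n, 1)` and `(n + 1, 0)` stand
for the same point. -/
noncomputable def translate (a : E) (x : ℕ ×ₗ E) : ℕ ×ₗ E :=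
  if h : (ofLex x).2 ≤ aᶜ then toLex ((ofLex x).1, (exists_padd h).choose)
  -- In a chain one of the two conditions holds, so the default `x` is never reached.
  else if h' : aᶜ ≤ (ofLex x).2 then toLex ((ofLex x).1 + 1, h'.choose) else x

theorem translate_of_padd {a t s : E} (h : padd t a = some s) (n : ℕ) :
    translate a (toLex (n, t)) = toLex (n, s) := by
  have h1 : t ≤ aᶜ := le_compl_of_padd h
  have hs : (exists_padd h1).choose = s :=
    Option.some.inj ((exists_padd h1).choose_spec.symm.trans h)
  exact (dif_pos (show (ofLex (toLex (n, t))).2 ≤ aᶜ from h1)).trans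
    (congrArg (fun u => toLex (n, u)) hs)

theorem translate_of_not_le {a t s : E} (h : ¬ t ≤ aᶜ) (hs : padd aᶜ s = some t) (n : ℕ) :
    translate a (toLex (n, t)) = toLex (n + 1, s) := by
  have h' : aᶜ ≤ t := ⟨s, hs⟩
  exact (dif_neg (show ¬ (ofLex (toLex (n, t))).2 ≤ aᶜ from h)).trans
    ((dif_pos (show aᶜ ≤ (ofLex (toLex (n, t))).2 from h')).trans
      (congrArg (fun u => toLex (n + 1, u)) (padd_left_cancel h'.choose_spec hs)))

/-- The number of times the multiples of `a` wrap around the unit, starting at `t`. -/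
noncomputable def wraps (a t : E) (k : ℕ) : ℕ := (ofLex ((translate a)^[k] (toLex (0, t)))).1

/-- Off by one: `translate` prefers (n, 1) to (n + 1, 0), so the first translation by 1 does not
wrap. -/
theorem wraps_one (h01 : (1 : E) ≠ 0) (k : ℕ) : wraps (1 : E) 0 (k + 1) = k := by
  have : (translate (1 : E))^[k + 1] (toLex (0, 0)) = toLex (k, 1) := by
    induction k with
    | zero => exact translate_of_padd (zero_padd 1) 0
    | succ k ih =>
      rw [Function.iterate_succ_apply', ih]
      refine translate_of_not_le (fun h => h01 ?_) ?_ k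
      · rw [compl_one_eq] at h
        exact eq_zero_of_le h
      · rw [compl_one_eq, zero_padd]
  unfold wraps
  rw [this]
  rfl

variable (hlin : ∀ a b : E, a ≤ b ∨ b ≤ a)
include hlin

theorem translate_cases (a t : E) (n : ℕ) :
    (∃ s, padd t a = some s ∧ translate a (toLex (n, t)) = toLex (n, s)) ∨
    (¬ t ≤ aᶜ ∧ ∃ s, padd aᶜ s = some t ∧ translate a (toLex (n, t)) = toLex (n + 1, s)) := by
  by_cases h : t ≤ aᶜ
  · obtain ⟨s, hs⟩ := exists_padd h
    exact Or.inl ⟨s, hs, translate_of_padd hs n⟩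
  · obtain ⟨s, hs⟩ := (hlin t aᶜ).resolve_left h
    exact Or.inr ⟨h, s, hs, translate_of_not_le h hs n⟩

theorem translate_translate {a b c : E} (hc : padd a b = some c) (x : ℕ ×ₗ E) :
    translate a (translate b x) = translate c x := by
  obtain ⟨n, t, rfl⟩ : ∃ n t, x = toLex (n, t) := ⟨_, _, rfl⟩
  have hba : padd b a = some c := by rwa [padd_comm]
  have hcb : padd cᶜ a = some bᶜ := padd_compl_of_padd hba
  have hca : padd cᶜ b = some aᶜ := padd_compl_of_padd hc
  rcases translate_cases hlin b t n with ⟨s, hs, hts⟩ | ⟨hn, s, hs, hts⟩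
  · rcases translate_cases hlin a s n with ⟨u, hu, hsu⟩ | ⟨hn, u, hu, hsu⟩
    · obtain ⟨f, hf, hf'⟩ := assoc_left hs hu
      rw [hba] at hf
      obtain rfl := Option.some.inj hf
      rw [hts, hsu, translate_of_padd hf']
    · -- `t + b = s = a' + u = c' + b + u`
      rw [padd_comm] at hca
      obtain ⟨f, hf, hf'⟩ := assoc_left hca hu
      rw [padd_comm] at hs
      obtain rfl := padd_left_cancel hs hf'
      rw [hts, hsu, translate_of_not_le (fun hle => hn ?_) hf]
      obtain ⟨w, hw⟩ := exists_padd hle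
      obtain ⟨g, hg, hg'⟩ := assoc_right hba hw
      rw [padd_comm, hs] at hg
      obtain rfl := Option.some.inj hg
      exact le_compl_of_padd hg'
  -- Here b' = c' + a, so t = b' + s = c' + (a + s): once b has wrapped, a does not.
  · obtain ⟨f, hf, hf'⟩ := assoc_left hcb hs
    rw [padd_comm] at hf
    rw [hts, translate_of_padd hf, translate_of_not_le (fun hle => hn ?_) hf']
    exact hle.trans (compl_le_compl' (le_of_padd_right hc))

theorem translate_mono (a : E) : Monotone (translate a) := by
  intro x y hxy
  obtain ⟨n, t, rfl⟩ : ∃ n t, x = toLex (n, t) := ⟨_, _, rfl⟩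
  obtain ⟨m, u, rfl⟩ : ∃ n t, y = toLex (n, t) := ⟨_, _, rfl⟩
  rw [Prod.Lex.toLex_le_toLex] at hxy
  rcases translate_cases hlin a t n with ⟨s, hs, hts⟩ | ⟨hn, s, hs, hts⟩ <;>
    rcases translate_cases hlin a u m with ⟨v, hv, huv⟩ | ⟨hm, v, hv, huv⟩ <;>
    rw [hts, huv, Prod.Lex.toLex_le_toLex] <;>
    simp only at hxy ⊢
  · rcases hxy with h | ⟨h, h'⟩
    · exact Or.inl h
    · exact Or.inr ⟨h, padd_le_padd hs hv h' le_rfl⟩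
  · left
    omega
  · rcases hxy with h | ⟨h, h'⟩
    · rcases (Nat.succ_le_of_lt h).lt_or_eq with h2 | h2
      · exact Or.inl h2
      -- The wrapped point lands at s ≤ a, because a' + s = t ≤ 1 = a' + a; the unwrapped point one
      -- row up lands above a.
      · refine Or.inr ⟨h2, le_trans ?_ (le_of_padd_right hv)⟩
        exact (padd_le_padd_iff hs (compl_padd a)).1 (le_one t)
    · exact absurd (h'.trans (le_compl_of_padd hv)) hn
  · rcases hxy with h | ⟨h, h'⟩
    · left
      omega
    · exact Or.inr ⟨by omega, (padd_le_padd_iff hs hv).1 h'⟩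

theorem translate_iterate_shift (a t : E) (k n : ℕ) :
    (translate a)^[k] (toLex (n, t)) =
      toLex (n + wraps a t k, (ofLex ((translate a)^[k] (toLex (0, t)))).2) := by
  induction k with
  | zero => rfl
  | succ k ih =>
    unfold wraps at *
    rw [Function.iterate_succ_apply', Function.iterate_succ_apply', ih]
    obtain ⟨m, u, hx⟩ : ∃ m u, (translate a)^[k] (toLex (0, t)) = toLex (m, u) := ⟨_, _, rfl⟩
    rw [hx]
    simp only [ofLex_toLex]
    by_cases h : u ≤ aᶜ
    · obtain ⟨s, hs⟩ := exists_padd h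
      rw [translate_of_padd hs, translate_of_padd hs]
      rfl
    · obtain ⟨s, hs⟩ := (hlin u aᶜ).resolve_left h
      rw [translate_of_not_le h hs, translate_of_not_le h hs]
      rfl

/-- By monotonicity the orbit of (0, t) runs between those of (0, 0) and (1, 0), and the latter is
the former shifted by one row. -/
theorem wraps_bounds (a t : E) (k : ℕ) :
    wraps a 0 k ≤ wraps a t k ∧ wraps a t k ≤ wraps a 0 k + 1 := by
  have hfst : ∀ x y : ℕ ×ₗ E, x ≤ y → (ofLex x).1 ≤ (ofLex y).1 := fun x y h => by
    rw [Prod.Lex.le_iff] at h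
    rcases h with h | h
    · exact h.le
    · exact h.1.le
  have hm := (translate_mono hlin a).iterate k
  constructor
  · refine hfst _ _ (hm ?_)
    rw [Prod.Lex.toLex_le_toLex]
    exact Or.inr ⟨rfl, zero_le t⟩
  · have := hfst _ _ (hm (a := toLex (0, t)) (b := toLex (1, 0)) (by
      rw [Prod.Lex.toLex_le_toLex]
      exact Or.inl Nat.zero_lt_one))
    rw [translate_iterate_shift hlin a 0 k 1] at this
    simp only [ofLex_toLex] at this
    unfold wraps at *
    omega

/-- Translations by a and b commute and compose to translation by c, so k steps of c are k steps of
b followed by k steps of a. The changed starting point costs at most one wrap. -/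
theorem wraps_padd {a b c : E} (hc : padd a b = some c) (k : ℕ) :
    wraps a 0 k + wraps b 0 k ≤ wraps c 0 k ∧ wraps c 0 k ≤ wraps a 0 k + wraps b 0 k + 1 := by
  have hcomp : translate c = translate a ∘ translate b :=
    funext fun x => (translate_translate hlin hc x).symm
  have hcomm : Function.Commute (translate a) (translate b) := fun x => by
    rw [translate_translate hlin hc, translate_translate hlin (by rwa [padd_comm])]
  have : wraps c 0 k = wraps b 0 k + wraps a (ofLex ((translate b)^[k] (toLex (0, 0)))).2 k := by
    conv_lhs => unfold wraps
    rw [hcomp, hcomm.comp_iterate, Function.comp_apply, translate_iterate_shift hlin b 0 k 0,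
      translate_iterate_shift hlin a]
    simp only [ofLex_toLex, Nat.zero_add]
  have hb := wraps_bounds hlin a (ofLex ((translate b)^[k] (toLex (0, 0)))).2 k
  omega

theorem wraps_le (a : E) (k : ℕ) : wraps a 0 k ≤ k := by
  induction k with
  | zero => exact le_rfl
  | succ k ih =>
    unfold wraps at *
    rw [Function.iterate_succ_apply']
    obtain ⟨m, u, hx⟩ : ∃ m u, (translate a)^[k] (toLex (0, 0)) = toLex (m, u) := ⟨_, _, rfl⟩
    rw [hx] at ih ⊢
    rcases translate_cases hlin a u m with ⟨s, -, h⟩ | ⟨-, s, -, h⟩ <;> rw [h] <;>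
      simp only [ofLex_toLex] at ih ⊢ <;> omega

/-- A nontrivial totally ordered effect algebra has a state. -/
theorem nonempty_state_of_linear (h01 : (1 : E) ≠ 0) : Nonempty (State E) := by
  -- The state is the rotation number: the limit of wraps per step along a nonprincipal ultrafilter.
  -- Additivity up to one wrap becomes exact after division by k.
  have hlim : ∀ a : E, ∃ r ∈ Icc (0 : ℝ) 1,
      Tendsto (fun k : ℕ => (wraps a 0 k : ℝ) / k) (hyperfilter ℕ) (𝓝 r) := fun a => by
    refine isCompact_Icc.ultrafilter_le_nhds'
      ((hyperfilter ℕ).map fun k : ℕ => (wraps a 0 k : ℝ) / k)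
      (Ultrafilter.mem_map.2 (Eventually.of_forall fun k => ?_))
    have : (wraps a 0 k : ℝ) ≤ k := by exact_mod_cast wraps_le hlin a k
    exact ⟨by positivity, div_le_one_of_le₀ this (by positivity)⟩
  choose f hf hlim using hlim
  have hinv : Tendsto (fun k : ℕ => (1 : ℝ) / k) (hyperfilter ℕ) (𝓝 0) :=
    tendsto_one_div_atTop_nhds_zero_nat.mono_left Nat.hyperfilter_le_atTop
  refine ⟨⟨f, fun a => (hf a).1, ?_, fun a b c hc => ?_⟩⟩
  · refine tendsto_nhds_unique (hlim 1) ?_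
    have h1 : Tendsto (fun k : ℕ => 1 - (1 : ℝ) / k) (hyperfilter ℕ) (𝓝 1) := by
      simpa using tendsto_const_nhds.sub hinv
    refine h1.congr' ?_
    have : ∀ᶠ k : ℕ in hyperfilter ℕ, 1 ≤ k :=
      Nat.hyperfilter_le_atTop (eventually_ge_atTop 1)
    filter_upwards [this] with k hk
    obtain ⟨k, rfl⟩ := Nat.exists_eq_add_of_le' hk
    rw [wraps_one h01]
    have : ((k + 1 : ℕ) : ℝ) ≠ 0 := by positivity
    field_simp
    push_cast
    ring
  · have h1 : Tendsto (fun k : ℕ => (wraps c 0 k : ℝ) / k - (wraps a 0 k : ℝ) / k -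
        (wraps b 0 k : ℝ) / k) (hyperfilter ℕ) (𝓝 (f c - f a - f b)) :=
      ((hlim c).sub (hlim a)).sub (hlim b)
    have h2 : Tendsto (fun k : ℕ => (wraps c 0 k : ℝ) / k - (wraps a 0 k : ℝ) / k -
        (wraps b 0 k : ℝ) / k) (hyperfilter ℕ) (𝓝 0) := by
      refine squeeze_zero (fun k => ?_) (fun k => ?_) hinv
      · have : (wraps a 0 k + wraps b 0 k : ℝ) ≤ wraps c 0 k := by
          exact_mod_cast (wraps_padd hlin hc k).1
        rw [← sub_div, ← sub_div]
        exact div_nonneg (by linarith) (by positivity)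
      · have : (wraps c 0 k : ℝ) ≤ wraps a 0 k + wraps b 0 k + 1 := by
          exact_mod_cast (wraps_padd hlin hc k).2
        rw [← sub_div, ← sub_div]
        exact div_le_div_of_nonneg_right (by linarith) (by positivity)
    have := tendsto_nhds_unique h1 h2
    linarith

end Linear

end EffectAlgebra

/-! ### Generic states on σ-complete MV-effect algebras -/

namespace EffectAlgebra

namespace SigmaMV

variable {E : Type*} [EffectAlgebra E] [SigmaMV E]

/-- A proper prime ideal is annihilated by some state. -/
theorem exists_state_of_isPrime (P : MVIdeal E) (hP : P.IsPrime) (h1 : 1 ∉ P.carrier) :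
    ∃ h : State E, ∀ p ∈ P.carrier, h.toFun p = 0 := by
  obtain ⟨g⟩ := nonempty_state_of_linear (P.quot_le_total hP) (fun h => h1 (by
    have h' : P.proj 1 = P.proj 0 := h
    rw [P.proj_eq, SigmaMV.tsub_zero] at h'
    exact h'.1))
  refine ⟨⟨fun a => g.toFun (P.proj a), fun a => g.nonneg _, g.map_one,
    fun a b c hc => g.map_padd _ _ _ (P.padd_proj hc)⟩, fun p hp => ?_⟩
  change g.toFun (P.proj p) = 0
  rw [P.proj_eq_zero hp, g.map_zero]

/-- The iterated truncated difference `b ∸ k · d`. -/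
noncomputable def tsubIter (b d : E) : ℕ → E
  | 0 => b
  | k + 1 => tsub (tsubIter b d k) d

theorem tsubIter_le (b d : E) (k : ℕ) : tsubIter b d k ≤ b := by
  induction k with
  | zero => exact le_rfl
  | succ k ih => exact (tsub_le _ _).trans ih

theorem tsubIter_mono (b : E) {d d' : E} (h : d ≤ d') (k : ℕ) :
    tsubIter b d' k ≤ tsubIter b d k := by
  induction k with
  | zero => exact le_rfl
  | succ k ih => exact tsub_le_tsub ih h

/-- If b ∸ (k+1)·d n = 0 for all n, then b ∸ k·d n ≤ d n; since d decreases, each b ∸ k·d n is below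
every d m, hence 0. Descending in k gives b = 0. -/
theorem exists_tsubIter_ne_zero {b : E} (hb : b ≠ 0) {d : ℕ → E} (hd : Antitone d)
    (hinf : IsGLB (range d) 0) (k : ℕ) : ∃ n, tsubIter b (d n) k ≠ 0 := by
  by_contra! h
  refine hb ?_
  induction k with
  | zero => exact h 0
  | succ k ih =>
    refine ih fun n => eq_zero_of_le (hinf.2 ?_)
    rintro _ ⟨m, rfl⟩
    have h' : ∀ i, tsubIter b (d i) k ≤ d i := fun i => tsub_eq_zero.1 (h i)
    rcases le_total n m with hnm | hmn
    · exact (tsubIter_mono b (hd hnm) k).trans (h' m)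
    · exact (h' n).trans (hd hmn)

section StateOfPrime

variable {P : MVIdeal E} {h : State E}

theorem state_eq_inf (h : State E) (a b : E) :
    h.toFun a = h.toFun (a ⊓ b) + h.toFun (tsub a b) := h.map_padd _ _ _ (inf_padd_tsub a b)

theorem state_le_of_tsub_mem (hh : ∀ p ∈ P.carrier, h.toFun p = 0) {a b : E}
    (hab : tsub a b ∈ P.carrier) : h.toFun a = h.toFun (a ⊓ b) := by
  rw [state_eq_inf h a b, hh _ hab, add_zero]

/-- A remainder outside P means that in the totally ordered quotient no subtraction was truncated,
so h sees each one exactly. Hence k · h(d) ≤ h(b) ≤ 1. -/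
theorem state_tsubIter (hP : P.IsPrime) (hh : ∀ p ∈ P.carrier, h.toFun p = 0) {b d : E} {k : ℕ}
    (hk : tsubIter b d k ∉ P.carrier) : h.toFun b = h.toFun (tsubIter b d k) + k * h.toFun d := by
  induction k with
  | zero => simp [tsubIter]
  | succ k ih =>
    have h1 := ih fun hmem => hk (P.mem_of_le _ _ (tsub_le _ _) hmem)
    have h2 := state_le_of_tsub_mem hh ((hP _ _).resolve_left hk)
    have h3 := state_eq_inf h (tsubIter b d k) d
    rw [inf_comm] at h2
    rw [h1, h3, ← h2]
    change _ = h.toFun (tsub (tsubIter b d k) d) + _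
    push_cast
    ring

theorem state_tadd_le (h : State E) (a b : E) : h.toFun (tadd a b) ≤ h.toFun a + h.toFun b := by
  rw [h.map_padd _ _ _ (padd_inf_compl a b)]
  linarith [h.mono (inf_le_right : aᶜ ⊓ b ≤ b)]

theorem state_tmul_le (h : State E) (a : E) (k : ℕ) : h.toFun (tmul a k) ≤ k * h.toFun a := by
  induction k with
  | zero => simp [tmul, h.map_zero]
  | succ k ih =>
    have := state_tadd_le h (tmul a k) a
    change h.toFun (tadd (tmul a k) a) ≤ _
    push_cast
    linarith

end StateOfPrime

/-- A Rasiowa-Sikorski lemma: elements `e ≰ f` are separated by a state that preserves countably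
many given decreasing limits. -/
theorem exists_generic_state {e f : E} (hef : ¬ e ≤ f) (d : ℕ → ℕ → E) (hd : ∀ j, Antitone (d j))
    (hinf : ∀ j, IsGLB (range (d j)) 0) :
    ∃ h : State E, h.toFun f < h.toFun e ∧ ∀ j, ∀ ε > 0, ∃ n, h.toFun (d j n) < ε := by
  set c := tsub e f with hc
  have hc0 : c ≠ 0 := fun h => hef (tsub_eq_zero.1 h)
  obtain ⟨k, hk⟩ := exists_tmul_not_le hc0
  have hstep : ∀ (i : ℕ) (b : {b : E // b ≠ 0}), ∃ n,
      tsubIter b.1 (d i.unpair.1 n) i.unpair.2 ≠ 0 := fun i b =>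
    exists_tsubIter_ne_zero b.2 (hd _) (hinf _) _
  choose N hN using hstep
  -- The initial element will force h(c) > 0; step i = pair(j, m) will force h(d j n) ≤ 1/m for some
  -- n.
  let b : ℕ → {b : E // b ≠ 0} := fun i => Nat.rec
    ⟨tsub (tmul c k) cᶜ, fun h => hk (tsub_eq_zero.1 h)⟩
    (fun i b => ⟨tsubIter b.1 (d i.unpair.1 (N i b)) i.unpair.2, hN i b⟩) i
  have hb : Antitone fun i => (b i).1 := antitone_nat_of_succ_le fun i => tsubIter_le _ _ _
  obtain ⟨P, hP, hbP⟩ := MVIdeal.exists_isPrime_avoiding hb fun i => (b i).2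
  obtain ⟨h, hh⟩ := exists_state_of_isPrime P hP fun h1 =>
    hbP 0 (P.mem_of_le _ _ (le_one _) h1)
  refine ⟨h, ?_, fun j ε hε => ?_⟩
  · have hb0 : tsub (tmul c k) cᶜ ∉ P.carrier := hbP 0
    have hcP : c ∉ P.carrier := fun hmem => hb0 (P.mem_of_le _ _
      ((tsub_le_compl _ _).trans_eq (compl_compl' c)) hmem)
    -- Modulo P, c' lies below k·c, so 1 - h(c) ≤ k · h(c) and h(c) > 0. As c = e ∸ f is not in P, f
    -- ∸ e is, and h(e) - h(f) = h(c).
    have h1 := state_le_of_tsub_mem hh ((hP _ _).resolve_left hb0)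
    have h2 := h.mono (inf_le_right : cᶜ ⊓ tmul c k ≤ _)
    have h3 := state_tmul_le h c k
    rw [← h1, h.map_compl] at h2
    have hpos : 0 < h.toFun c := by
      rcases (h.nonneg c).lt_or_eq with h0 | h0
      · exact h0
      · rw [← h0, mul_zero] at h3
        rw [← h0] at h2
        linarith
    have h4 := state_le_of_tsub_mem hh ((hP e f).resolve_left hcP)
    rw [state_eq_inf h e f, h4, inf_comm]
    linarith
  · obtain ⟨m, hm⟩ := exists_nat_gt (1 / ε)
    set i := Nat.pair j m with hi
    refine ⟨N i (b i), ?_⟩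
    have h1 : tsubIter (b i).1 (d i.unpair.1 (N i (b i))) i.unpair.2 ∉ P.carrier := hbP (i + 1)
    have h2 := state_tsubIter hP hh h1
    have h3 := h.nonneg (tsubIter (b i).1 (d i.unpair.1 (N i (b i))) i.unpair.2)
    have h4 := h.le_one (b i).1
    have hij : i.unpair = (j, m) := Nat.unpair_pair j m
    rw [hij] at h2 h3
    simp only at h2 h3
    have hm0 : (0 : ℝ) < m := lt_trans (by positivity) hm
    have h5 : (m : ℝ) * h.toFun (d j (N i (b i))) ≤ 1 := by linarith
    rw [div_lt_iff₀ hε] at hm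
    by_contra! hle
    have := mul_le_mul_of_nonneg_left hle hm0.le
    linarith

end SigmaMV

end EffectAlgebra

/-! ### Distribution functions and values at Borel sets -/

open MeasureTheory

/-- Push Lebesgue measure on (0,1) forward along the quantile function Q(u) = inf {r | u < G r}.
Left continuity of G makes the preimage of (-∞, q) equal to (0, G q). -/
theorem exists_probability_Iio_rat (G : ℚ → ℝ) (hG : Monotone G) (h0 : ∀ q ≤ 0, G q = 0)
    (h1 : ∀ q > 1, G q = 1) (hl : ∀ q, ∀ ε > 0, ∃ r < q, G q - ε < G r) :
    ∃ μ : Measure ℝ, IsProbabilityMeasure μ ∧ ∀ q : ℚ, μ.real (Iio (q : ℝ)) = G q := by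
  let T : ℝ → Set ℝ := fun u => (fun r : ℚ => (r : ℝ)) '' {r | u < G r}
  have hbdd : ∀ u ∈ Ioo (0 : ℝ) 1, BddBelow (T u) := by
    rintro u ⟨hu, -⟩
    refine ⟨0, ?_⟩
    rintro _ ⟨r, hr, rfl⟩
    by_contra! hr0
    have : r ≤ 0 := by exact_mod_cast hr0.le
    rw [mem_ofPred_eq, h0 r this] at hr
    linarith
  have hne : ∀ u ∈ Ioo (0 : ℝ) 1, (T u).Nonempty := fun u hu =>
    ⟨_, 2, by rw [mem_ofPred_eq, h1 2 (by norm_num)]; exact hu.2, rfl⟩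
  let Q : ℝ → ℝ := fun u => sInf (T u)
  have hQ : MonotoneOn Q (Ioo 0 1) := fun u hu v hv huv =>
    csInf_le_csInf (hbdd u hu) (hne v hv) (image_mono fun r hr => lt_of_le_of_lt huv hr)
  have hQm : AEMeasurable Q (volume.restrict (Ioo 0 1)) :=
    aemeasurable_restrict_of_monotoneOn measurableSet_Ioo hQ
  have hprob : IsProbabilityMeasure (volume.restrict (Ioo (0 : ℝ) 1)) := ⟨by simp⟩
  refine ⟨(volume.restrict (Ioo 0 1)).map Q, Measure.isProbabilityMeasure_map hQm, fun q => ?_⟩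
  have hG0 : 0 ≤ G q := by
    rw [← h0 (min q 0) (min_le_right _ _)]
    exact hG (min_le_left _ _)
  have hG1 : G q ≤ 1 := by
    rw [← h1 (max q 2) (lt_of_lt_of_le (by norm_num) (le_max_right _ _))]
    exact hG (le_max_left _ _)
  have hset : Q ⁻¹' Iio (q : ℝ) ∩ Ioo 0 1 = Ioo 0 (G q) := by
    ext u
    constructor
    · rintro ⟨hu, hu1⟩
      obtain ⟨_, ⟨r, hr, rfl⟩, hrq⟩ := exists_lt_of_csInf_lt (hne u hu1) hu
      have hrq : r ≤ q := by
        have : (r : ℝ) < q := hrq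
        exact_mod_cast this.le
      exact ⟨hu1.1, lt_of_lt_of_le hr (hG hrq)⟩
    · rintro ⟨hu0, hu⟩
      have hu1 : u ∈ Ioo (0 : ℝ) 1 := ⟨hu0, hu.trans_le hG1⟩
      obtain ⟨r, hrq, hr⟩ := hl q (G q - u) (by linarith)
      refine ⟨lt_of_le_of_lt (csInf_le (hbdd u hu1) ⟨r, ?_, rfl⟩) ?_, hu1⟩
      · change u < G r
        linarith
      · change (r : ℝ) < q
        exact_mod_cast hrq
  rw [Measure.real, Measure.map_apply_of_aemeasurable hQm measurableSet_Iio,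
    Measure.restrict_apply' measurableSet_Ioo, hset, Real.volume_Ioo, sub_zero,
    ENNReal.toReal_ofReal hG0]

namespace EffectAlgebra

section Values

variable {E : Type*} [EffectAlgebra E]

/-- The sequence decreases to `0`. -/
def DecreasesToZero (d : ℕ → E) : Prop := Antitone d ∧ IsGLB (range d) 0

/-- The state `h` maps the sequence `d` to a sequence that comes arbitrarily close to `0`. -/
def Vanishes (h : State E) (d : ℕ → E) : Prop := ∀ ε > 0, ∃ n, h.toFun (d n) < ε

/-- `a` is the value at `A` of the observable with resolution `F`: all sufficiently generic states
evaluate `a` to the measure of `A`. -/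
def IsValue (F : ℝ → E) (A : Set ℝ) (a : E) : Prop :=
  ∃ 𝒟 : Set (ℕ → E), 𝒟.Countable ∧ (∀ d ∈ 𝒟, DecreasesToZero d) ∧
    ∀ h : State E, (∀ d ∈ 𝒟, Vanishes h d) → ∀ μ : Measure ℝ, IsProbabilityMeasure μ →
      (∀ q : ℚ, μ.real (Iio (q : ℝ)) = h.toFun (F q)) → μ.real A = h.toFun a

/-- The conditions on a function to be the spectral resolution of an observable with spectrum
in `[0, 1]`. -/
structure IsResolution (F : ℝ → E) : Prop where
  mono : Monotone F
  isLUB : ∀ t, IsLUB (F '' Iio t) (F t)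
  eq_zero : ∀ t ≤ 0, F t = 0
  eq_one : ∀ t > 1, F t = 1

theorem isValue_Iio (F : ℝ → E) (q : ℚ) : IsValue F (Iio (q : ℝ)) (F q) :=
  ⟨∅, countable_empty, fun _ hd => hd.elim, fun _ _ _ _ hμ => hμ q⟩

theorem isValue_univ (F : ℝ → E) : IsValue F univ 1 :=
  ⟨∅, countable_empty, fun _ hd => hd.elim, fun h _ μ _ _ => by
    rw [h.map_one, probReal_univ]⟩

theorem isValue_empty (F : ℝ → E) : IsValue F ∅ 0 :=
  ⟨∅, countable_empty, fun _ hd => hd.elim, fun h _ μ _ _ => by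
    rw [h.map_zero, measureReal_empty]⟩

theorem IsValue.compl {F : ℝ → E} {A : Set ℝ} (hA : MeasurableSet A) {a : E}
    (ha : IsValue F A a) : IsValue F Aᶜ aᶜ := by
  obtain ⟨𝒟, hc, h𝒟, H⟩ := ha
  refine ⟨𝒟, hc, h𝒟, fun h hh μ hμ hμF => ?_⟩
  rw [h.map_compl, ← H h hh μ hμ hμF, probReal_compl_eq_one_sub hA]

end Values

namespace SigmaMV

variable {E : Type*} [EffectAlgebra E] [SigmaMV E]

/-- If w is below every a ∸ f n, then f n ≤ a - w for all n, so a ≤ a - w and w = 0. A state along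
which these differences vanish is thus continuous along f. -/
theorem decreasesToZero_tsub {f : ℕ → E} {a : E} (hf : Monotone f) (ha : IsLUB (range f) a) :
    DecreasesToZero fun n => tsub a (f n) := by
  refine ⟨fun m n hmn => tsub_le_tsub le_rfl (hf hmn), ?_, fun w hw => ?_⟩
  · rintro _ ⟨n, rfl⟩
    exact zero_le _
  · have hwa : w ≤ a := (hw ⟨0, rfl⟩).trans (tsub_le _ _)
    obtain ⟨v, hv⟩ := hwa
    have hav : a ≤ v := ha.2 (by
      rintro _ ⟨n, rfl⟩
      have h1 := padd_tsub a (f n)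
      rw [sup_eq_left.2 (ha.1 ⟨n, rfl⟩)] at h1
      obtain ⟨t, ht, hta⟩ := exists_padd_of_le h1 (hw ⟨n, rfl⟩)
      rw [padd_comm] at ht
      exact (padd_le_padd_iff ht hv).1 hta)
    have h2 : v = a := le_antisymm (le_of_padd_right hv) hav
    subst h2
    exact (padd_right_cancel hv (zero_padd v)).le

theorem state_tsub_of_le (h : State E) {a b : E} (hab : b ≤ a) :
    h.toFun (tsub a b) = h.toFun a - h.toFun b := by
  have := state_eq_inf h a b
  rw [inf_eq_right.2 hab] at this
  linarith

theorem exists_state_vanishes {e f : E} (hef : ¬ e ≤ f) {𝒟 : Set (ℕ → E)} (hc : 𝒟.Countable)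
    (h𝒟 : ∀ d ∈ 𝒟, DecreasesToZero d) :
    ∃ h : State E, h.toFun f < h.toFun e ∧ ∀ d ∈ 𝒟, Vanishes h d := by
  rcases 𝒟.eq_empty_or_nonempty with rfl | hne
  · obtain ⟨h, hh, -⟩ := exists_generic_state hef (fun _ _ => 0) (fun _ => antitone_const)
      (fun _ => by rw [range_const]; exact isGLB_singleton)
    exact ⟨h, hh, fun d hd => hd.elim⟩
  · obtain ⟨D, rfl⟩ := hc.exists_eq_range hne
    obtain ⟨h, hh, hD⟩ := exists_generic_state hef D (fun j => (h𝒟 _ ⟨j, rfl⟩).1)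
      (fun j => (h𝒟 _ ⟨j, rfl⟩).2)
    refine ⟨h, hh, ?_⟩
    rintro _ ⟨j, rfl⟩
    exact hD j

/-- The increments of `F` below `q`. -/
noncomputable def increment (F : ℝ → E) (q : ℚ) (n : ℕ) : E := tsub (F q) (F (q - 1 / (n + 1)))

theorem decreasesToZero_increment {F : ℝ → E} (hF : IsResolution F) (q : ℚ) :
    DecreasesToZero (increment F q) := by
  refine decreasesToZero_tsub (f := fun n : ℕ => F (q - 1 / (n + 1))) (fun m n hmn => ?_) ?_
  · exact hF.mono (sub_le_sub_left (Nat.one_div_le_one_div hmn) _)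
  · constructor
    · rintro _ ⟨n, rfl⟩
      exact hF.mono (by linarith [Nat.one_div_pos_of_nat (α := ℝ) (n := n)])
    · intro u hu
      refine (hF.isLUB q).2 ?_
      rintro _ ⟨s, hs, rfl⟩
      obtain ⟨n, hn⟩ := exists_nat_one_div_lt (sub_pos.2 (mem_Iio.1 hs))
      exact (hF.mono (by linarith)).trans (hu ⟨n, rfl⟩)

theorem exists_probability {F : ℝ → E} (hF : IsResolution F) (h : State E)
    (hh : ∀ q, Vanishes h (increment F q)) :
    ∃ μ : Measure ℝ, IsProbabilityMeasure μ ∧ ∀ q : ℚ, μ.real (Iio (q : ℝ)) = h.toFun (F q) := by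
  refine exists_probability_Iio_rat (fun q => h.toFun (F q)) ?_ ?_ ?_ ?_
  · intro q r hqr
    exact h.mono (hF.mono (by exact_mod_cast hqr))
  · intro q hq
    rw [hF.eq_zero q (by exact_mod_cast hq), h.map_zero]
  · intro q hq
    rw [hF.eq_one q (by exact_mod_cast hq), h.map_one]
  · intro q ε hε
    obtain ⟨n, hn⟩ := hh q ε hε
    have hpos := Nat.one_div_pos_of_nat (α := ℚ) (n := n)
    refine ⟨q - 1 / (n + 1), by linarith, ?_⟩
    have hle : (q : ℝ) - 1 / (n + 1) ≤ q := by
      linarith [Nat.one_div_pos_of_nat (α := ℝ) (n := n)]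
    unfold increment at hn
    rw [state_tsub_of_le h (hF.mono hle)] at hn
    push_cast
    linarith

/-- If a ≰ b, some state h generic for both values and for the increments of F has h(b) < h(a). The
increments provide a measure μ with distribution function h ∘ F, so μ(B) < μ(A) although A ⊆ B. -/
theorem _root_.EffectAlgebra.IsValue.le {F : ℝ → E} (hF : IsResolution F) {A B : Set ℝ} {a b : E}
    (ha : IsValue F A a) (hb : IsValue F B b) (hAB : A ⊆ B) : a ≤ b := by
  obtain ⟨𝒟, hc, h𝒟, H⟩ := ha
  obtain ⟨𝒟', hc', h𝒟', H'⟩ := hb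
  by_contra hab
  obtain ⟨h, hlt, hh⟩ := exists_state_vanishes hab
    (hc.union (hc'.union (countable_range fun q : ℚ => increment F q))) (by
      rintro d (hd | hd | ⟨q, rfl⟩)
      · exact h𝒟 d hd
      · exact h𝒟' d hd
      · exact decreasesToZero_increment hF q)
  obtain ⟨μ, hμ, hμF⟩ := exists_probability hF h fun q => hh _ (Or.inr (Or.inr ⟨q, rfl⟩))
  rw [← H h (fun d hd => hh d (Or.inl hd)) μ hμ hμF,
    ← H' h (fun d hd => hh d (Or.inr (Or.inl hd))) μ hμ hμF] at hlt
  exact absurd (measureReal_mono hAB) (not_le.2 hlt)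

theorem _root_.EffectAlgebra.IsValue.unique {F : ℝ → E} (hF : IsResolution F) {A : Set ℝ} {a b : E}
    (ha : IsValue F A a) (hb : IsValue F A b) : a = b :=
  le_antisymm (ha.le hF hb subset_rfl) (hb.le hF ha subset_rfl)

theorem _root_.EffectAlgebra.IsValue.union {F : ℝ → E} (hF : IsResolution F) {A B : Set ℝ}
    (hB : MeasurableSet B) (hAB : Disjoint A B) {a b : E} (ha : IsValue F A a)
    (hb : IsValue F B b) : ∃ c, padd a b = some c ∧ IsValue F (A ∪ B) c := by
  obtain ⟨c, hc⟩ := exists_padd (ha.le hF (hb.compl hB) hAB.subset_compl_right)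
  refine ⟨c, hc, ?_⟩
  obtain ⟨𝒟, hcount, h𝒟, H⟩ := ha
  obtain ⟨𝒟', hcount', h𝒟', H'⟩ := hb
  refine ⟨𝒟 ∪ 𝒟', hcount.union hcount', fun d hd => hd.elim (h𝒟 d) (h𝒟' d),
    fun h hh μ hμ hμF => ?_⟩
  rw [h.map_padd _ _ _ hc, measureReal_union hAB hB,
    H h (fun d hd => hh d (Or.inl hd)) μ hμ hμF, H' h (fun d hd => hh d (Or.inr hd)) μ hμ hμF]

/-- Adding the single sequence a ∸ f n to the prescribed ones forces h(f n) → h(a), matching μ(A n)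
→ μ(⋃ A n). -/
theorem _root_.EffectAlgebra.IsValue.iUnion {F : ℝ → E} (hF : IsResolution F) {A : ℕ → Set ℝ}
    (hA : Monotone A) {f : ℕ → E} (hf : ∀ n, IsValue F (A n) (f n)) {a : E}
    (ha : IsLUB (range f) a) : IsValue F (⋃ n, A n) a := by
  have hmono : Monotone f := fun m n hmn => (hf m).le hF (hf n) (hA hmn)
  choose 𝒟 hc h𝒟 H using hf
  refine ⟨(⋃ n, 𝒟 n) ∪ {fun n => tsub a (f n)}, (countable_iUnion hc).union (countable_singleton _),
    ?_, fun h hh μ hμ hμF => ?_⟩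
  · rintro d (hd | rfl)
    · obtain ⟨n, hn⟩ := mem_iUnion.1 hd
      exact h𝒟 n d hn
    · exact decreasesToZero_tsub hmono ha
  · have hn : ∀ n, μ.real (A n) = h.toFun (f n) := fun n =>
      H n h (fun d hd => hh d (Or.inl (mem_iUnion.2 ⟨n, hd⟩))) μ hμ hμF
    have h1 : Tendsto (fun n => μ.real (A n)) atTop (𝓝 (μ.real (⋃ n, A n))) :=
      (ENNReal.tendsto_toReal (measure_ne_top _ _)).comp (tendsto_measure_iUnion_atTop hA)
    have h2 : Tendsto (fun n => μ.real (A n)) atTop (𝓝 (h.toFun a)) := by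
      simp only [hn]
      refine tendsto_atTop_isLUB (fun m n hmn => h.mono (hmono hmn)) ⟨?_, fun u hu => ?_⟩
      · rintro _ ⟨n, rfl⟩
        exact h.mono (ha.1 ⟨n, rfl⟩)
      · refine le_of_forall_pos_lt_add fun ε hε => ?_
        obtain ⟨n, hn⟩ := hh _ (Or.inr rfl) ε hε
        rw [state_tsub_of_le h (ha.1 ⟨n, rfl⟩)] at hn
        have : h.toFun (f n) ≤ u := hu ⟨n, rfl⟩
        linarith
    exact tendsto_nhds_unique h1 h2

theorem exists_isValue {F : ℝ → E} (hF : IsResolution F) (A : Set ℝ) (hA : MeasurableSet A) :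
    ∃ a, IsValue F A a := by
  induction A, hA using MeasurableSpace.induction_on_inter
    (Real.borel_eq_generateFrom_Iio_rat ▸ BorelSpace.measurable_eq) Real.isPiSystem_Iio_rat with
  | empty => exact ⟨0, isValue_empty F⟩
  | basic t ht =>
    obtain ⟨q, rfl⟩ := mem_iUnion.1 ht
    exact ⟨F q, isValue_Iio F q⟩
  | compl t ht ih =>
    obtain ⟨a, ha⟩ := ih
    exact ⟨aᶜ, ha.compl ht⟩
  | iUnion f hd hf ih =>
    have hfin : ∀ n : ℕ, ∃ a, IsValue F (⋃ i < n, f i) a := by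
      intro n
      induction n with
      | zero => exact ⟨0, by simpa using isValue_empty F⟩
      | succ n ihn =>
        obtain ⟨a, ha⟩ := ihn
        obtain ⟨b, hb⟩ := ih n
        have hdis : Disjoint (⋃ i < n, f i) (f n) := by
          simp only [disjoint_iUnion_left]
          exact fun i hi => hd hi.ne
        obtain ⟨c, -, hc⟩ := ha.union hF (hf n) hdis hb
        rw [biUnion_lt_succ f n]
        exact ⟨c, hc⟩
    choose g hg using hfin
    obtain ⟨a, ha⟩ := exists_isLUB_seq sigma g
    have hmono : Monotone fun n : ℕ => ⋃ i < n, f i :=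
      fun m n hmn => biUnion_mono (fun i hi => lt_of_lt_of_le hi hmn) fun _ _ => subset_rfl
    have hu : (⋃ n : ℕ, ⋃ i < n, f i) = ⋃ i, f i := by
      ext r
      simp only [mem_iUnion, exists_prop]
      exact ⟨fun ⟨_, i, _, h⟩ => ⟨i, h⟩, fun ⟨i, h⟩ => ⟨i + 1, i, Nat.lt_succ_self i, h⟩⟩
    exact ⟨a, hu ▸ IsValue.iUnion hF hmono hg ha⟩

end SigmaMV

/-! ### From resolutions to observables -/

open SigmaMV in
/-- Every resolution on a `σ`-lattice effect algebra comes from an observable. -/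
theorem exists_observable {E : Type*} [EffectAlgebra E] (hE : IsSigmaLatticeOrder E) {F : ℝ → E}
    (hF : IsResolution F) : ∃ x : Observable E, ∀ t, x.resolution t = F t := by
  have hcompat : ∀ a ∈ range F, ∀ b ∈ range F, Compat a b := by
    rintro _ ⟨s, rfl⟩ _ ⟨t, rfl⟩
    rcases le_total s t with h | h
    · exact compat_of_le (hF.mono h)
    · exact compat_of_ge (hF.mono h)
  set M := bicommutant hE (range F) with hM
  have : SigmaMV M.Elem := sigmaMV_bicommutant hE hcompat
  let G : ℝ → M.Elem := fun t => ⟨F t, subset_bicommutant hE _ ⟨t, rfl⟩⟩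
  have hG : IsResolution G := by
    refine ⟨fun s t hst => M.coe_le.2 (hF.mono hst), fun t => M.isLUB_of_coe ?_,
      fun t ht => SubEffectAlgebra.Elem.ext (hF.eq_zero t ht),
      fun t ht => SubEffectAlgebra.Elem.ext (hF.eq_one t ht)⟩
    rw [image_image]
    exact hF.isLUB t
  choose v hv using fun B : BorelSet => exists_isValue hG B.1 B.2
  have hv' : ∀ (B : BorelSet) {a}, IsValue G B.1 a → v B = a := fun B a ha => (hv B).unique hG ha
  let x : Observable E :=
    { toFun := fun B => (v B).val
      map_univ := congrArg SubEffectAlgebra.Elem.val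
        (hv' ⟨univ, MeasurableSet.univ⟩ (isValue_univ G))
      map_union := fun A B hAB => by
        obtain ⟨c, hc, hval⟩ := (hv A).union hG B.2 hAB (hv B)
        rw [hv' ⟨A.1 ∪ B.1, _⟩ hval]
        exact M.padd_eq_some_iff.1 hc
      map_iUnion := fun A hA => by
        obtain ⟨a, ha⟩ := exists_isLUB_seq sigma fun i => v (A i)
        have hval := IsValue.iUnion hG (monotone_nat_of_le_succ hA) (fun i => hv (A i)) ha
        rw [hv' ⟨⋃ i, (A i).1, _⟩ hval]
        have := isLUB_coe_bicommutant hE (countable_range _) (range_nonempty _) ha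
        rwa [← range_comp] at this }
  have hrat : ∀ q : ℚ, x.resolution q = F q := fun q =>
    congrArg SubEffectAlgebra.Elem.val (hv' ⟨Iio (q : ℝ), measurableSet_Iio⟩ (isValue_Iio G q))
  refine ⟨x, fun t => ?_⟩
  -- `IsValue` fixes the measure on rational half-lines only; for other t both sides are left
  -- continuous.
  obtain ⟨u, hu, hlt, htend⟩ := Real.exists_seq_rat_strictMono_tendsto t
  have hexists : ∀ s < t, ∃ n, s < u n := fun s hs =>
    (htend.eventually (lt_mem_nhds hs)).exists
  have h1 := x.map_iUnion (fun n => ⟨Iio (u n : ℝ), measurableSet_Iio⟩) fun n =>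
    Iio_subset_Iio (by exact_mod_cast (hu n.lt_succ_self).le)
  have hU : (⟨⋃ n, Iio (u n : ℝ), MeasurableSet.iUnion fun n => measurableSet_Iio⟩ : BorelSet) =
      ⟨Iio t, measurableSet_Iio⟩ := by
    refine Subtype.ext (subset_antisymm ?_ fun s hs => mem_iUnion.2 (hexists s hs))
    exact iUnion_subset fun n => Iio_subset_Iio (hlt n).le
  have h2 : IsLUB (range fun n => x.resolution (u n)) (x.resolution t) := by
    have h3 : x.resolution t = x ⟨⋃ n, Iio (u n : ℝ), MeasurableSet.iUnion fun n =>
      measurableSet_Iio⟩ := congrArg x.toFun hU.symm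
    rw [h3]
    exact h1
  refine h2.unique ?_
  simp only [hrat]
  constructor
  · rintro _ ⟨n, rfl⟩
    exact hF.mono (hlt n).le
  · intro w hw
    refine (hF.isLUB t).2 ?_
    rintro _ ⟨s, hs, rfl⟩
    obtain ⟨n, hn⟩ := hexists s hs
    exact (hF.mono hn.le).trans (hw ⟨n, rfl⟩)

end EffectAlgebra

/-! ### Null sets, spectrum and half-lines -/

namespace Observable

open EffectAlgebra

variable {E : Type*} [EffectAlgebra E]

theorem mono (x : Observable E) {A B : BorelSet} (h : A.1 ⊆ B.1) : x A ≤ x B := by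
  refine ⟨x ⟨B.1 \ A.1, B.2.diff A.2⟩, ?_⟩
  rw [x.map_union A ⟨B.1 \ A.1, B.2.diff A.2⟩ disjoint_sdiff_right]
  congr 3
  exact union_sdiff_cancel h

theorem eq_zero_of_subset (x : Observable E) {A B : BorelSet} (h : A.1 ⊆ B.1) (hB : x B = 0) :
    x A = 0 := eq_zero_of_le (hB ▸ x.mono h)

theorem eq_one_of_compl_eq_zero (x : Observable E) {A B : BorelSet} (h : A.1ᶜ ⊆ B.1)
    (hB : x B = 0) : x A = 1 := by
  have h1 := x.eq_zero_of_subset (A := ⟨A.1ᶜ, A.2.compl⟩) h hB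
  rw [x.map_compl] at h1
  rw [← compl_compl' (x A), h1, compl_zero_eq]

theorem union_eq_zero (x : Observable E) {A B : BorelSet} (hA : x A = 0) (hB : x B = 0) :
    x ⟨A.1 ∪ B.1, A.2.union B.2⟩ = 0 := by
  have h := x.map_union A ⟨B.1 \ A.1, B.2.diff A.2⟩ disjoint_sdiff_right
  rw [hA, x.eq_zero_of_subset sdiff_subset hB, padd_zero] at h
  rw [Option.some.inj h]
  congr 2
  exact union_sdiff_self.symm

theorem iUnion_eq_zero (x : Observable E) {F : ℕ → BorelSet} (hF : ∀ n, x (F n) = 0) :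
    x ⟨⋃ n, (F n).1, MeasurableSet.iUnion fun n => (F n).2⟩ = 0 := by
  have hm : ∀ n : ℕ, MeasurableSet (⋃ i < n, (F i).1) := fun n =>
    MeasurableSet.biUnion (to_countable _) fun i _ => (F i).2
  have hfin : ∀ n : ℕ, x ⟨⋃ i < n, (F i).1, hm n⟩ = 0 := by
    intro n
    induction n with
    | zero => exact x.eq_zero_of_subset (B := ⟨∅, MeasurableSet.empty⟩) (by simp) x.map_empty
    | succ n ih =>
      refine x.eq_zero_of_subset ?_ (x.union_eq_zero ih (hF n))
      exact (biUnion_lt_succ (fun i => (F i).1) n).subset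
  have h := x.map_iUnion (fun n => ⟨⋃ i < n, (F i).1, hm n⟩) fun n =>
    biUnion_mono (fun _ hi => Nat.lt_succ_of_lt hi) fun _ _ => subset_rfl
  refine x.eq_zero_of_subset (B := ⟨⋃ n : ℕ, ⋃ i < n, (F i).1, _⟩) ?_ (eq_zero_of_le (h.2 ?_))
  · exact iUnion_subset fun n r hr => mem_iUnion.2 ⟨n + 1, mem_biUnion (Nat.lt_succ_self n) hr⟩
  · rintro _ ⟨n, rfl⟩
    exact (hfin n).le

/-- The complement of the spectrum is a null set. -/
theorem eq_zero_of_disjoint_spectrum (x : Observable E) {A : BorelSet}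
    (hA : Disjoint A.1 x.spectrum) : x A = 0 := by
  let 𝒰 : Set (Set ℝ) := {U | ∃ hU : IsOpen U, x ⟨U, hU.measurableSet⟩ = 0}
  -- The complement of the spectrum is covered by null open sets; by the Lindelöf property countably
  -- many suffice.
  obtain ⟨𝒯, hc, hsub, hT⟩ := TopologicalSpace.isOpen_sUnion_countable 𝒰 fun U hU => hU.1
  have hAU : A.1 ⊆ ⋃₀ 𝒯 := by
    rw [hT]
    intro r hr
    have hr' : r ∉ x.spectrum := disjoint_left.1 hA hr
    simp only [spectrum, mem_sInter, not_forall] at hr'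
    obtain ⟨K, ⟨hK, hx⟩, hrK⟩ := hr'
    refine ⟨Kᶜ, ⟨hK.isOpen_compl, ?_⟩, hrK⟩
    exact (x.map_compl ⟨K, hK.measurableSet⟩).trans (by rw [hx, compl_one_eq])
  rcases 𝒯.eq_empty_or_nonempty with rfl | hne
  · rw [sUnion_empty] at hAU
    exact x.eq_zero_of_subset (B := ⟨∅, MeasurableSet.empty⟩) hAU x.map_empty
  · obtain ⟨U, rfl⟩ := hc.exists_eq_range hne
    choose hU hxU using fun n => hsub (mem_range_self n)
    refine x.eq_zero_of_subset ?_ (x.iUnion_eq_zero (F := fun n => ⟨U n, (hU n).measurableSet⟩) hxU)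
    rwa [sUnion_range] at hAU

theorem spectrum_subset_of_compl_eq_zero (x : Observable E)
    (h : x ⟨(Icc 0 1)ᶜ, measurableSet_Icc.compl⟩ = 0) : x.spectrum ⊆ Icc (0 : ℝ) 1 :=
  fun _ hr => hr _ ⟨isClosed_Icc, x.eq_one_of_compl_eq_zero subset_rfl h⟩

theorem spectrum_subset_of_resolution (x : Observable E) (h0 : x.resolution 0 = 0)
    (h1 : ∀ t > 1, x.resolution t = 1) : x.spectrum ⊆ Icc (0 : ℝ) 1 := by
  refine fun r hr => ⟨hr _ ⟨isClosed_Ici, x.eq_one_of_compl_eq_zero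
    (B := ⟨Iio 0, measurableSet_Iio⟩) compl_Ici.subset h0⟩,
    le_of_forall_gt_imp_ge_of_dense fun t ht => hr _ ⟨isClosed_Iic, ?_⟩⟩
  refine eq_one_of_le ((h1 t ht).symm.trans_le ?_)
  exact x.mono (A := ⟨Iio t, measurableSet_Iio⟩) Iio_subset_Iic_self

theorem resolution_mono (x : Observable E) {s t : ℝ} (h : s ≤ t) :
    x.resolution s ≤ x.resolution t := x.mono (Iio_subset_Iio h)

theorem isLUB_Iio (x : Observable E) (t : ℝ) :
    IsLUB (range fun n : ℕ => x.resolution (t - 1 / (n + 1))) (x.resolution t) := by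
  have h := x.map_iUnion (fun n : ℕ => ⟨Iio (t - 1 / (n + 1)), measurableSet_Iio⟩) fun n =>
    Iio_subset_Iio (sub_le_sub_left (Nat.one_div_le_one_div n.le_succ) _)
  have hU : (⟨⋃ n : ℕ, Iio (t - 1 / ((n : ℝ) + 1)),
      MeasurableSet.iUnion fun n => measurableSet_Iio⟩ : BorelSet) =
      ⟨Iio t, measurableSet_Iio⟩ := by
    refine Subtype.ext (subset_antisymm (iUnion_subset fun n => Iio_subset_Iio ?_) fun s hs => ?_)
    · linarith [Nat.one_div_pos_of_nat (α := ℝ) (n := n)]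
    · obtain ⟨n, hn⟩ := exists_nat_one_div_lt (sub_pos.2 (mem_Iio.1 hs))
      exact mem_iUnion.2 ⟨n, by rw [mem_Iio]; linarith⟩
  have h3 : x.resolution t = x ⟨⋃ n : ℕ, Iio (t - 1 / ((n : ℝ) + 1)),
    MeasurableSet.iUnion fun n => measurableSet_Iio⟩ := congrArg x.toFun hU.symm
  rw [h3]
  exact h

theorem isLUB_Ioi (x : Observable E) (t : ℝ) :
    IsLUB (range fun n : ℕ => (x.resolution (t + 1 / (n + 1)))ᶜ)
      (x ⟨Ioi t, measurableSet_Ioi⟩) := by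
  have h := x.map_iUnion (fun n : ℕ => ⟨(Iio (t + 1 / (n + 1)))ᶜ, measurableSet_Iio.compl⟩) fun n =>
    compl_subset_compl.2 (Iio_subset_Iio (add_le_add_right (Nat.one_div_le_one_div n.le_succ) _))
  have hU : (⟨⋃ n : ℕ, (Iio (t + 1 / ((n : ℝ) + 1)))ᶜ,
      MeasurableSet.iUnion fun n => measurableSet_Iio.compl⟩ : BorelSet) =
      ⟨Ioi t, measurableSet_Ioi⟩ := by
    refine Subtype.ext (subset_antisymm (iUnion_subset fun n r hr => ?_) fun s hs => ?_)
    · have : t + 1 / ((n : ℝ) + 1) ≤ r := not_lt.1 hr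
      rw [mem_Ioi]
      linarith [Nat.one_div_pos_of_nat (α := ℝ) (n := n)]
    · obtain ⟨n, hn⟩ := exists_nat_one_div_lt (sub_pos.2 (mem_Ioi.1 hs))
      refine mem_iUnion.2 ⟨n, ?_⟩
      rw [mem_compl_iff, mem_Iio]
      linarith
  rw [← hU]
  have h4 : ∀ t, x ⟨(Iio t)ᶜ, measurableSet_Iio.compl⟩ = (x.resolution t)ᶜ := fun t =>
    x.map_compl ⟨Iio t, measurableSet_Iio⟩
  simpa only [h4] using h

/-- (t, ∞) is the increasing union of the complements of (-∞, t + 1/(n+1)). Negation turns lower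
half-lines into these upper ones, so this makes it antitone. -/
theorem map_Ioi_mono {x y : Observable E} (h : x ≤ y) (t : ℝ) :
    x ⟨Ioi t, measurableSet_Ioi⟩ ≤ y ⟨Ioi t, measurableSet_Ioi⟩ := by
  refine (x.isLUB_Ioi t).2 ?_
  rintro _ ⟨n, rfl⟩
  exact (compl_le_compl' (h _)).trans ((y.isLUB_Ioi t).1 ⟨n, rfl⟩)

theorem question_resolution (a : E) (t : ℝ) :
    (question a).resolution t = if t ≤ 0 then 0 else if t ≤ 1 then aᶜ else 1 := by
  simp only [resolution, question, mem_Iio]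
  split_ifs with h0 h1 <;> first | rfl | (exfalso; linarith)

theorem question_apply (a : E) (B : BorelSet) :
    question a B = 0 ∨ question a B = 1 ∨ question a B = a ∨ question a B = aᶜ := by
  simp only [question]
  split_ifs <;> simp

end Observable

/-! ### Sharp elements and sharp questions -/

namespace EffectAlgebra

variable {E : Type*} [EffectAlgebra E]

theorem isSharp_compl_iff {a : E} : IsSharp aᶜ ↔ IsSharp a := by
  unfold IsSharp
  rw [compl_compl', pair_comm]

theorem isSharp_zero : IsSharp (0 : E) :=
  ⟨by rintro _ (rfl | rfl); exacts [le_rfl, zero_le _], fun _ h => h (by simp)⟩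

theorem question_isSharp_iff (a : E) : (Observable.question a).IsSharp ↔ IsSharp a := by
  constructor
  · intro h
    have := h ⟨{1}, measurableSet_singleton 1⟩
    simpa [Observable.question] using this
  · intro h B
    rcases Observable.question_apply a B with h' | h' | h' | h' <;> rw [h']
    · exact isSharp_zero
    · rw [← compl_zero_eq, isSharp_compl_iff]
      exact isSharp_zero
    · exact h
    · rwa [isSharp_compl_iff]

end EffectAlgebra

/-! ### The lattice structure and negation of 𝓔𝓞(E) -/

namespace EO

open EffectAlgebra

variable {E : Type*} [EffectAlgebra E]

theorem apply_compl_Icc (x : EO E) : x.1 ⟨(Icc 0 1)ᶜ, measurableSet_Icc.compl⟩ = 0 :=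
  x.1.eq_zero_of_disjoint_spectrum (disjoint_left.2 fun _ h h' => h (x.2 h'))

theorem resolution_eq_zero (x : EO E) {t : ℝ} (ht : t ≤ 0) : x.1.resolution t = 0 :=
  x.1.eq_zero_of_subset (B := ⟨(Icc 0 1)ᶜ, measurableSet_Icc.compl⟩) (fun r hr h => by
    have : r < t := hr
    linarith [h.1]) x.apply_compl_Icc

theorem resolution_eq_one (x : EO E) {t : ℝ} (ht : 1 < t) : x.1.resolution t = 1 :=
  x.1.eq_one_of_compl_eq_zero (B := ⟨(Icc 0 1)ᶜ, measurableSet_Icc.compl⟩) (fun r hr h => hr (by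
    have := h.2
    rw [mem_Iio]
    linarith)) x.apply_compl_Icc

/-- A Borel function preserving `[0, 1]` acts on `𝓔𝓞(E)`. -/
theorem map_mem (x : EO E) {f : ℝ → ℝ} (hf : Measurable f)
    (h : ∀ t ∈ Icc (0 : ℝ) 1, f t ∈ Icc (0 : ℝ) 1) :
    (x.1.map f hf).spectrum ⊆ Icc (0 : ℝ) 1 :=
  (x.1.map f hf).spectrum_subset_of_compl_eq_zero
    (x.1.eq_zero_of_subset (B := ⟨(Icc 0 1)ᶜ, measurableSet_Icc.compl⟩)
      (fun t ht ht' => ht (h t ht')) x.apply_compl_Icc)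

theorem ext_resolution {x y : EO E} (h : ∀ t, x.1.resolution t = y.1.resolution t) : x = y :=
  Subtype.ext (Observable.eq_of_resolution h)

theorem neg_resolution (x : EO E) (t : ℝ) :
    x.neg.1.resolution t = x.1 ⟨Ioi (1 - t), measurableSet_Ioi⟩ := by
  change x.1 _ = _
  congr 2
  ext r
  simp only [mem_preimage, mem_Iio, mem_Ioi]
  exact sub_lt_comm

theorem neg_le_neg {x y : EO E} (h : x ≤ y) : y.neg ≤ x.neg := by
  intro t
  rw [neg_resolution, neg_resolution]
  exact Observable.map_Ioi_mono h _

theorem neg_neg (x : EO E) : x.neg.neg = x := by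
  refine Subtype.ext (Observable.ext (funext fun B => ?_))
  change x.1 _ = x.1 _
  congr 2
  ext r
  simp

theorem neg_question (a : E) : (question a).neg = question aᶜ := by
  refine ext_resolution fun t => ?_
  rw [neg_resolution]
  change _ = (Observable.question aᶜ).resolution t
  rw [Observable.question_resolution, compl_compl']
  change (Observable.question a) _ = _
  simp only [Observable.question, mem_Ioi]
  split_ifs <;> first | rfl | (exfalso; linarith)

theorem isLUB_neg {S : Set (EO E)} {m : EO E} (h : IsGLB S m) : IsLUB (neg '' S) m.neg := by
  constructor
  · rintro _ ⟨x, hx, rfl⟩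
    exact neg_le_neg (h.1 hx)
  · intro u hu
    rw [← neg_neg u]
    refine neg_le_neg (h.2 fun x hx => ?_)
    rw [← neg_neg x]
    exact neg_le_neg (hu ⟨x, hx, rfl⟩)

/-- Infima in `𝓔𝓞(E)` are pointwise suprema of spectral resolutions. -/
theorem isGLB_of_resolution {S : Set (EO E)} {m : EO E}
    (h : ∀ t, 0 < t → t ≤ 1 → IsLUB ((fun x : EO E => x.1.resolution t) '' S) (m.1.resolution t)) :
    IsGLB S m := by
  have hout : ∀ x y : EO E, ∀ t : ℝ, ¬ (0 < t ∧ t ≤ 1) → x.1.resolution t ≤ y.1.resolution t := by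
    intro x y t ht
    by_cases h0 : 0 < t
    · rw [y.resolution_eq_one (lt_of_not_ge fun h1 => ht ⟨h0, h1⟩)]
      exact le_one _
    · rw [x.resolution_eq_zero (not_lt.1 h0)]
      exact zero_le _
  constructor
  · intro x hx t
    by_cases ht : 0 < t ∧ t ≤ 1
    · exact (h t ht.1 ht.2).1 ⟨x, hx, rfl⟩
    · exact hout x m t ht
  · intro z hz t
    by_cases ht : 0 < t ∧ t ≤ 1
    · refine (h t ht.1 ht.2).2 ?_
      rintro _ ⟨x, hx, rfl⟩
      exact hz hx t
    · exact hout m z t ht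

theorem question_resolution_of_mem (a : E) {t : ℝ} (h0 : 0 < t) (h1 : t ≤ 1) :
    (question a).1.resolution t = aᶜ := by
  change (Observable.question a).resolution t = _
  rw [Observable.question_resolution, if_neg (not_le.2 h0), if_pos h1]

theorem isGLB_question {a b c : E} (h : IsGLB {a, b} c) :
    IsGLB {question a, question b} (question c) := by
  refine isGLB_of_resolution fun t h0 h1 => ?_
  rw [image_pair]
  simp only [question_resolution_of_mem _ h0 h1]
  have := isLUB_compl h
  rwa [image_pair] at this

theorem isLUB_question {a b c : E} (h : IsLUB {a, b} c) :
    IsLUB {question a, question b} (question c) := by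
  have h1 := isGLB_compl h
  rw [image_pair] at h1
  have h2 := isLUB_neg (isGLB_question h1)
  rw [image_pair] at h2
  simpa only [neg_question, compl_compl'] using h2

theorem isSharp_iff (a : E) :
    EffectAlgebra.IsSharp a ↔ IsGLB {question a, (question a).neg} (question 0) := by
  rw [neg_question]
  refine ⟨isGLB_question, fun h => ⟨?_, fun w hw => ?_⟩⟩
  · rintro _ (rfl | rfl) <;> exact zero_le _
  -- Monotonicity of `question`: w ≤ b makes w the infimum of {w, b}.
  · have key : ∀ b, w ≤ b → question w ≤ question b := fun b hb => by
      refine (isGLB_question (a := w) (b := b) (c := w) ?_).1 (by simp)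
      exact ⟨by rintro _ (rfl | rfl); exacts [le_rfl, hb], fun _ hu => hu (by simp)⟩
    have hle : question w ≤ question 0 := h.2 (by
      rintro _ (rfl | rfl)
      · exact key _ (hw (by simp))
      · exact key _ (hw (by simp)))
    have h1 := hle 1
    rw [question_resolution_of_mem _ one_pos le_rfl, question_resolution_of_mem _ one_pos le_rfl,
      compl_le_compl_iff] at h1
    exact h1

/-- The top element is q_1. For t > 1 an empty pointwise supremum would be 0 instead of 1, which is
why `isGLB_of_resolution` looks only at (0,1]. -/
theorem exists_isGLB_empty : ∃ m : EO E, IsGLB ∅ m := by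
  refine ⟨question 1, isGLB_of_resolution fun t h0 h1 => ?_⟩
  rw [image_empty, question_resolution_of_mem _ h0 h1, compl_one_eq]
  exact ⟨by simp, fun _ _ => zero_le _⟩

/-- The infimum exists if the pointwise suprema of the spectral resolutions do. -/
theorem exists_isGLB_of_exists_isLUB (hE : IsSigmaLatticeOrder E) {S : Set (EO E)}
    (hS : S.Nonempty)
    (h : ∀ t, ∃ u, IsLUB ((fun x : EO E => x.1.resolution t) '' S) u) : ∃ m, IsGLB S m := by
  choose F hF using h
  obtain ⟨x₀, hx₀⟩ := hS
  have hres : IsResolution F := by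
    have hmono : Monotone F := fun s t hst => (hF s).2 (by
      rintro _ ⟨x, hx, rfl⟩
      exact (x.1.resolution_mono hst).trans ((hF t).1 ⟨x, hx, rfl⟩))
    refine ⟨hmono, fun t => ⟨?_, fun u hu => (hF t).2 ?_⟩, fun t ht => ?_, fun t ht => ?_⟩
    · rintro _ ⟨s, hs, rfl⟩
      exact hmono (le_of_lt hs)
    -- Left continuity of F: suprema over x and over s < t are interchanged.
    · rintro _ ⟨x, hx, rfl⟩
      refine (x.1.isLUB_Iio t).2 ?_
      rintro _ ⟨n, rfl⟩
      refine ((hF _).1 ⟨x, hx, rfl⟩).trans (hu ⟨_, ?_, rfl⟩)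
      rw [mem_Iio]
      linarith [Nat.one_div_pos_of_nat (α := ℝ) (n := n)]
    · refine eq_zero_of_le ((hF t).2 ?_)
      rintro _ ⟨x, hx, rfl⟩
      exact (x.resolution_eq_zero ht).le
    -- Nonemptiness of S matters only here.
    · exact eq_one_of_le ((x₀.resolution_eq_one ht).symm.trans_le ((hF t).1 ⟨x₀, hx₀, rfl⟩))
  obtain ⟨m, hm⟩ := exists_observable hE hres
  refine ⟨⟨m, m.spectrum_subset_of_resolution (by rw [hm, hres.eq_zero 0 le_rfl])
    fun t ht => by rw [hm, hres.eq_one t ht]⟩, isGLB_of_resolution fun t _ _ => ?_⟩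
  rw [hm]
  exact hF t

theorem exists_isGLB_of_countable (hE : IsSigmaLatticeOrder E) {S : Set (EO E)}
    (hS : S.Countable) : ∃ m, IsGLB S m := by
  rcases S.eq_empty_or_nonempty with rfl | hne
  · exact exists_isGLB_empty
  · exact exists_isGLB_of_exists_isLUB hE hne fun t => (hE _ (hS.image _) (hne.image _)).2

theorem exists_isGLB_of_complete (hE : IsSigmaLatticeOrder E) (hC : IsCompleteLatticeOrder E)
    (S : Set (EO E)) : ∃ m, IsGLB S m := by
  rcases S.eq_empty_or_nonempty with rfl | hne
  · exact exists_isGLB_empty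
  · exact exists_isGLB_of_exists_isLUB hE hne fun t => (hC _).2

theorem neg_image_neg_image (S : Set (EO E)) : neg '' (neg '' S) = S := by
  rw [image_image]
  simp only [neg_neg, image_id']

/-- The supremum of S is the negation of the infimum of the negated family. -/
theorem exists_de_morgan {S : Set (EO E)} (h : ∃ m, IsGLB S m) (h' : ∃ m, IsGLB (neg '' S) m) :
    (∃ m, IsGLB S m ∧ IsLUB (neg '' S) m.neg) ∧ ∃ m, IsLUB S m ∧ IsGLB (neg '' S) m.neg := by
  obtain ⟨m, hm⟩ := h
  obtain ⟨n, hn⟩ := h'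
  refine ⟨⟨m, hm, isLUB_neg hm⟩, n.neg, ?_, by rwa [neg_neg]⟩
  have := isLUB_neg hn
  rwa [neg_image_neg_image] at this

theorem map_min_le (x m : EO E) (hm : IsGLB {x, x.neg} m) :
    x.1.map (fun t => min t (1 - t)) (measurable_id.min EO.measurable_one_sub) ≤ m.1 := by
  let g : EO E := ⟨x.1.map (fun t => min t (1 - t)) (measurable_id.min EO.measurable_one_sub),
    x.map_mem _ fun t ht => ⟨le_min ht.1 (by linarith [ht.2]), (min_le_left _ _).trans ht.2⟩⟩
  refine (hm.2 ?_ : g ≤ m)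
  rintro y (hy | hy) t <;> rw [hy]
  · exact x.1.mono (A := ⟨Iio t, measurableSet_Iio⟩) fun r hr =>
      show min r (1 - r) < t from min_lt_iff.2 (Or.inl hr)
  · exact x.1.mono (A := ⟨(fun t => 1 - t) ⁻¹' Iio t, measurable_one_sub measurableSet_Iio⟩)
      fun r hr => show min r (1 - r) < t from min_lt_iff.2 (Or.inr hr)

theorem le_map_max (x m : EO E) (hm : IsLUB {x, x.neg} m) :
    m.1 ≤ x.1.map (fun t => max t (1 - t)) (measurable_id.max EO.measurable_one_sub) := by
  let g : EO E := ⟨x.1.map (fun t => max t (1 - t)) (measurable_id.max EO.measurable_one_sub),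
    x.map_mem _ fun t ht => ⟨ht.1.trans (le_max_left _ _), max_le ht.2 (by linarith [ht.1])⟩⟩
  refine (hm.2 ?_ : m ≤ g)
  rintro y (hy | hy) t <;> rw [hy]
  · exact x.1.mono (B := ⟨Iio t, measurableSet_Iio⟩) fun r (hr : max r (1 - r) < t) =>
      (max_lt_iff.1 hr).1
  · exact x.1.mono (B := ⟨(fun t => 1 - t) ⁻¹' Iio t, measurable_one_sub measurableSet_Iio⟩)
      fun r (hr : max r (1 - r) < t) => (max_lt_iff.1 hr).2

end EO

theorem theorem4p5 {E : Type*} [EffectAlgebra E] (hE : IsSigmaLatticeOrder E) :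
    -- the negation is order-reversing and involutive
    (∀ x y : EO E, x ≤ y → y.neg ≤ x.neg) ∧
    (∀ x : EO E, x.neg.neg = x) ∧
    -- negation of the constant questions
    ((EO.question (0 : E)).neg = EO.question 1 ∧ (EO.question (1 : E)).neg = EO.question 0) ∧
    -- De Morgan laws for countable families (which have infima and suprema)
    (∀ S : Set (EO E), S.Countable →
      (∃ m, IsGLB S m ∧ IsLUB (EO.neg '' S) m.neg) ∧
      (∃ m, IsLUB S m ∧ IsGLB (EO.neg '' S) m.neg)) ∧
    -- negation, meets and joins of questions
    (∀ a : E, (EO.question a).neg = EO.question aᶜ) ∧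
    (∀ a b c : E, IsGLB {a, b} c → IsGLB {EO.question a, EO.question b} (EO.question c)) ∧
    (∀ a b c : E, IsLUB {a, b} c → IsLUB {EO.question a, EO.question b} (EO.question c)) ∧
    -- comparison of `x ∧ x⁻`, `x ∨ x⁻` with `min {t, 1 - t}` and `max {t, 1 - t}` applied to `x`
    (∀ x m : EO E, IsGLB {x, x.neg} m →
      x.1.map (fun t => min t (1 - t)) (measurable_id.min EO.measurable_one_sub) ≤ m.1) ∧
    (∀ x m : EO E, IsLUB {x, x.neg} m →
      m.1 ≤ x.1.map (fun t => max t (1 - t)) (measurable_id.max EO.measurable_one_sub)) ∧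
    -- sharpness
    (∀ a : E, (Observable.question a).IsSharp ↔ EffectAlgebra.IsSharp a) ∧
    (∀ a : E, EffectAlgebra.IsSharp a ↔
      IsGLB {EO.question a, (EO.question a).neg} (EO.question 0)) ∧
    -- the complete case
    (IsCompleteLatticeOrder E →
      (∀ S : Set (EO E),
        (∃ m, IsGLB S m ∧ IsLUB (EO.neg '' S) m.neg) ∧
        (∃ m, IsLUB S m ∧ IsGLB (EO.neg '' S) m.neg)) ∧
      IsCompleteLatticeOrder (EO E) ∧ IsOrderInvolution (EO.neg : EO E → EO E)) := by

  refine ⟨fun _ _ => EO.neg_le_neg, EO.neg_neg, ⟨?_, ?_⟩, fun S hS => ?_, EO.neg_question,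
    fun _ _ _ => EO.isGLB_question, fun _ _ _ => EO.isLUB_question, EO.map_min_le, EO.le_map_max,
    EffectAlgebra.question_isSharp_iff, EO.isSharp_iff, fun hC => ?_⟩
  · rw [EO.neg_question, EffectAlgebra.compl_zero_eq]
  · rw [EO.neg_question, EffectAlgebra.compl_one_eq]
  · exact EO.exists_de_morgan (EO.exists_isGLB_of_countable hE hS)
      (EO.exists_isGLB_of_countable hE (hS.image _))
  · have hdm := fun S : Set (EO E) => EO.exists_de_morgan
      (EO.exists_isGLB_of_complete hE hC S) (EO.exists_isGLB_of_complete hE hC (EO.neg '' S))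
    refine ⟨hdm, fun S => ?_, EO.neg_neg, fun _ _ => EO.neg_le_neg⟩
    obtain ⟨⟨m, hm, -⟩, n, hn, -⟩ := hdm S
    exact ⟨⟨m, hm⟩, n, hn⟩
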